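/- Let $q\in(0,1)$, $n\in\mathbb{N}=\{1,2,\dots\}$, $I_q=\{q^{-m}:m\in\mathbb{N}\}$ and, for $k=1,\dots,n$, $X_{q,k}=I_q^{k-1}\times[0,\infty)$. Let $\nu$ be a $\sigma$-finite Borel measure on $[0,\infty)$ that is $q$-invariant, i.e. $\nu(qM)=\nu(M)$ for all Borel sets $M\subset[0,\infty)$, and satisfies $\nu(\{0\})=0$. Put $\mu_k=\delta\otimes\cdots\otimes\delta\otimes\nu$ on $X_{q,k}$, where $\delta$ is the counting measure on $I_q$ ($k-1$ factors), and $D_k=\{f\in L_2(X_{q,k},\mu_k): \operatorname{supp}(f)\subset I_q^{k-1}\times(0,\infty)\text{ is compact}\}$. For $h\in D_k$ set $$(z_kh)(t_1,\dots,t_k)=q\,t_k\,h(t_1,\dots,t_{k-1},qt_k),$$ $$(z_jh)(t_1,\dots,t_k)=\sqrt{(qt_j)^2-1}\;t_{j+1}\cdots t_k\,h(t_1,\dots,qt_j,\dots,t_k)\quad(j<k),$$ $$z_jh=0\quad(j>k)$$ (for $j<k$ the right-hand side is read as $0$ where $qt_j=1$). (a) These formulas define operators on $D_k$ which are closable, and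 their closures $z_1,\dots,z_n$ form a $*$-representation of the coordinate ring of the $n$-dimensional quantum complex plane on $L_2(X_{q,k},\mu_k)$ with common dense domain $D_k$, which is a core for every $z_j$: the operators $z_j,z_j^*$ leave $D_k$ invariant and on $D_k$ satisfy $z_jz_i=q\,z_iz_j$ for $j>i$, $z_jz_i^*=q\,z_i^*z_j$ for $j\ne i$, and $z_iz_i^*=q^2z_i^*z_i-(1-q^2)\sum_{j>i}z_j^*z_j$ for all $i$. Call this the concrete representation given by $(k,\nu)$. (b) Let $\mathcal H_0,\mathcal K_1,\dots,\mathcal K_n$ be Hilbert spaces and, for each $k$, let $A_k$ be a bounded self-adjoint operator on $\mathcal K_k$ with $\operatorname{spec}(A_k)\subset[q,1]$ such that $q$ is not an eigenvalue of $A_k$. Let $\mathcal H=\mathcal H_0\oplus\mathcal H_1\oplus\cdots\oplus\mathcal H_n$, where $\mathcal H_k$ is the Hilbert sum of copies $\mathcal G_{i_1,\dots,i_k}=\mathcal K_k$ with $i_1,\dots,i_{k-1}\in\mathbb{N}$, $i_k\in\mathbb{Z}$, and write $h_{i_1,\dots,i_k}$ for $h\in\mathcal K_k$ placed in $\mathcal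 G_{i_1,\dots,i_k}$. Let $D\subset\mathcal H$ be the algebraic direct sum of $\mathcal H_0$ and all $\mathcal G_{i_1,\dots,i_k}$, and let $z_1,\dots,z_n$ be the closed operators with core $D$ given by $z_j=0$ on $\mathcal H_0$ and, on $\mathcal H_k$, $$z_kh_{i_1,\dots,i_k}=q^{-i_k}(A_kh)_{i_1,\dots,i_{k-1},i_k+1},$$ $$z_jh_{i_1,\dots,i_k}=\sqrt{q^{-2i_j}-1}\;q^{-(i_{j+1}+\cdots+i_k)}(A_kh)_{i_1,\dots,i_j+1,\dots,i_k}\ (j<k),\qquad z_j=0\ (j>k).$$ Then there are a family of pairs $(k_a,\nu_a)_{a}$, with $k_a\in\{1,\dots,n\}$ and $\nu_a$ a measure as above, and a unitary operator $$U:\mathcal H\to \mathcal H_0\oplus\bigoplus_a L_2(X_{q,k_a},\mu_{k_a})$$ (with $\mu_{k_a}$ formed with $\nu_a$) which carries each closed operator $z_j$ to the orthogonal direct sum of the zero operator on $\mathcal H_0$ and the closed operators $z_j$ of the concrete representations given by $(k_a,\nu_a)$. Moreover, $U$ maps $D$ onto the set of those $(h_0,(f_a)_a)$ for which there are compact sets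 $C_k\subset I_q^{k-1}\times(0,\infty)$, $k=1,\dots,n$, with $\operatorname{supp}(f_a)\subset C_{k_a}$ for all $a$. -/

import Mathlib

open MeasureTheory Filter
open scoped NNReal ENNReal InnerProductSpace LinearPMap

universe u v w

noncomputable section

namespace QPlane

/-! ### Families of unbounded operators -/

section Generic

variable {E : Type u} [NormedAddCommGroup E] [InnerProductSpace ℂ E]
variable {F : Type v} [NormedAddCommGroup F] [InnerProductSpace ℂ F]

/-- The unitary `U` intertwines the closed operators `S 0, …, S (n-1)` with `T 0, …, T (n-1)`,
domains included: the graph of `T j` is the image of the graph of `S j`. -/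
def Intertwines {n : ℕ} (U : E ≃ₗᵢ[ℂ] F) (S : Fin n → E →ₗ.[ℂ] E) (T : Fin n → F →ₗ.[ℂ] F) :
    Prop :=
  ∀ (j : Fin n) (x y : E), (x, y) ∈ (S j).graph ↔ (U x, U y) ∈ (T j).graph

/-- `z 0, …, z (n-1)` (standing for `z_1, …, z_n`) form a `*`-representation of the coordinate
`*`-algebra of the `n`-dimensional quantum complex plane with common dense domain `D`: they are
densely defined closed operators, `D` is a core for each of them, `D` is invariant under all
`z j` and all adjoints `(z j)†`, and the defining relations hold on `D`. -/
structure IsStarRep (q : ℝ) {n : ℕ} [CompleteSpace E] (D : Submodule ℂ E)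
    (z : Fin n → E →ₗ.[ℂ] E) : Prop where
  dense : Dense (D : Set E)
  closed : ∀ j, (z j).IsClosed
  core : ∀ j, (z j).HasCore D
  relations : ∃ Z Zs : Fin n → Module.End ℂ D,
    (∀ (j : Fin n) (x : D), ((x : E), (Z j x : E)) ∈ (z j).graph) ∧
    (∀ (j : Fin n) (x : D), ((x : E), (Zs j x : E)) ∈ ((z j)†).graph) ∧
    (∀ i j, i < j → Z j * Z i = (q : ℂ) • (Z i * Z j)) ∧
    (∀ i j, i ≠ j → Z j * Zs i = (q : ℂ) • (Zs i * Z j)) ∧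
    (∀ i, Z i * Zs i = ((q : ℂ) ^ 2) • (Zs i * Z i) -
      (1 - (q : ℂ) ^ 2) • ∑ j ∈ Finset.univ.filter (fun j => i < j), Zs j * Z j)

/-- The operator `0 ⊕ T` on the orthogonal sum `E ⊕ F`. -/
def zeroSum (E : Type u) [NormedAddCommGroup E] [InnerProductSpace ℂ E] (T : F →ₗ.[ℂ] F) :
    WithLp 2 (E × F) →ₗ.[ℂ] WithLp 2 (E × F) where
  domain :=
    { carrier := {x | x.snd ∈ T.domain}
      add_mem' := fun ha hb => T.domain.add_mem ha hb
      zero_mem' := T.domain.zero_mem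
      smul_mem' := fun c _ ha => T.domain.smul_mem c ha }
  toFun :=
    { toFun := fun x => WithLp.toLp 2 (0, T ⟨x.1.snd, x.2⟩)
      map_add' := fun x y => by
        have h : T ⟨(x + y).1.snd, (x + y).2⟩ = T ⟨x.1.snd, x.2⟩ + T ⟨y.1.snd, y.2⟩ := by
          rw [← T.map_add]; rfl
        rw [h, ← WithLp.toLp_add, Prod.mk_add_mk, add_zero]
      map_smul' := fun c x => by
        have h : T ⟨(c • x).1.snd, (c • x).2⟩ = c • T ⟨x.1.snd, x.2⟩ := by
          rw [← T.map_smul]; rfl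
        rw [h, RingHom.id_apply, ← WithLp.toLp_smul, Prod.smul_mk, smul_zero] }

end Generic

/-- The orthogonal sum of unbounded operators `T i` on the Hilbert sum of the spaces `E i`:
its domain consists of the `x` with `x i ∈ dom (T i)` for all `i` and `∑ ‖T i (x i)‖² < ∞`. -/
def hilbertSum {ι : Type v} {E : ι → Type u} [∀ i, NormedAddCommGroup (E i)]
    [∀ i, InnerProductSpace ℂ (E i)] (T : ∀ i, E i →ₗ.[ℂ] E i) :
    lp E 2 →ₗ.[ℂ] lp E 2 where
  domain :=
    { carrier := {x | ∃ h : ∀ i, x i ∈ (T i).domain, Memℓp (fun i => T i ⟨x i, h i⟩) 2}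
      add_mem' := by
        rintro a b ⟨ha, ha'⟩ ⟨hb, hb'⟩
        refine ⟨fun i => (T i).domain.add_mem (ha i) (hb i), ?_⟩
        convert ha'.add hb' using 1
        funext i
        exact (T i).map_add ⟨a i, ha i⟩ ⟨b i, hb i⟩
      zero_mem' := by
        refine ⟨fun i => (T i).domain.zero_mem, ?_⟩
        convert zero_memℓp (E := E) (p := 2) using 1
        funext i
        exact (T i).map_zero
      smul_mem' := by
        rintro c a ⟨ha, ha'⟩
        refine ⟨fun i => (T i).domain.smul_mem c (ha i), ?_⟩
        convert ha'.const_smul c using 1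
        funext i
        exact (T i).map_smul c ⟨a i, ha i⟩ }
  toFun :=
    { toFun := fun x => ⟨fun i => T i ⟨x.1 i, x.2.1 i⟩, x.2.2⟩
      map_add' := fun x y => by
        ext i
        exact (T i).map_add ⟨x.1 i, x.2.1 i⟩ ⟨y.1 i, y.2.1 i⟩
      map_smul' := fun c x => by
        ext i
        exact (T i).map_smul c ⟨x.1 i, x.2.1 i⟩ }

/-! ### The classified representations

Throughout, `m : ℕ` is the number of discrete directions, so that `m = k - 1` for the
component with index `k ∈ {1, …, n}`, and `j : ℕ` stands for the generator `z_{j+1}`. -/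

/-- The index set `ℕ^{k-1} × ℤ` (with `m = k - 1` and `ℕ = {1, 2, …}`). -/
abbrev Idx (m : ℕ) : Type := (Fin m → ℕ+) × ℤ

/-- `(i_1, …, i_k) ↦ (i_1, …, i_j + 1, …, i_k)` -/
def raiseIdx (m j : ℕ) (i : Idx m) : Idx m :=
  if h : j < m then (Function.update i.1 ⟨j, h⟩ (i.1 ⟨j, h⟩ + 1), i.2)
  else if j = m then (i.1, i.2 + 1) else i

/-- The coefficient of the action of `z_j` on the component with multi-index `i`. -/
def stdCoef (q : ℝ) (m j : ℕ) (i : Idx m) : ℝ :=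
  if h : j < m then
    √(q ^ (-2 * ((i.1 ⟨j, h⟩ : ℕ) : ℤ)) - 1) *
      q ^ (-((∑ l ∈ Finset.univ.filter (fun l : Fin m => j < l), ((i.1 l : ℕ) : ℤ)) + i.2))
  else if j = m then q ^ (-i.2) else 0

section Standard

variable {K : Type u} [NormedAddCommGroup K] [InnerProductSpace ℂ K]

/-- The Hilbert sum of copies of `K` indexed by `ℕ^{k-1} × ℤ`. -/
abbrev StdSpace (m : ℕ) (K : Type u) [NormedAddCommGroup K] : Type u :=
  lp (fun _ : Idx m => K) 2

/-- The algebraic orthogonal sum of the copies of `K`. -/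
def stdDomain (m : ℕ) (K : Type u) [NormedAddCommGroup K] [InnerProductSpace ℂ K] :
    Submodule ℂ (StdSpace m K) where
  carrier := {x | {i | x i ≠ 0}.Finite}
  add_mem' := by
    intro a b ha hb
    refine (Set.Finite.union ha hb).subset fun i hi => ?_
    by_contra hc
    simp only [Set.mem_union, Set.mem_ofPred_eq, not_or, not_not] at hc
    exact hi (by simp [hc.1, hc.2])
  zero_mem' := by simp
  smul_mem' := by
    intro c a ha
    refine Set.Finite.subset ha fun i hi hc => hi ?_
    simp [hc]

theorem stdTerm_finite (q : ℝ) (m j : ℕ) (A : K →L[ℂ] K) (x : stdDomain m K) :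
    (fun i : Idx m => lp.single (E := fun _ : Idx m => K) 2 (raiseIdx m j i)
      ((stdCoef q m j i : ℂ) • A (x.1 i))).HasFiniteSupport := by
  refine Set.Finite.subset x.2 fun i hi hc => hi ?_
  simp [hc]

/-- The operator `h_i ↦ stdCoef i • (A h)_{raiseIdx i}` on the algebraic orthogonal sum, where
`h_i = lp.single 2 i h` is the vector with `h` in the component `i` and `0` elsewhere. -/
def stdOp (q : ℝ) (m : ℕ) (A : K →L[ℂ] K) (j : ℕ) : StdSpace m K →ₗ.[ℂ] StdSpace m K where
  domain := stdDomain m K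
  toFun :=
    { toFun := fun x => ∑ᶠ i : Idx m, lp.single (E := fun _ : Idx m => K) 2 (raiseIdx m j i)
        ((stdCoef q m j i : ℂ) • A (x.1 i))
      map_add' := fun x y => by
        rw [← finsum_add_distrib (stdTerm_finite q m j A x) (stdTerm_finite q m j A y)]
        refine finsum_congr fun i => ?_
        rw [← lp.single_add, ← smul_add, ← map_add]
        rfl
      map_smul' := fun c x => by
        rw [RingHom.id_apply, smul_finsum' c (stdTerm_finite q m j A x)]
        refine finsum_congr fun i => ?_
        rw [← lp.single_smul, smul_comm c, ← A.map_smul c]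
        rfl }

end Standard

/-! ### The concrete representations on `L²`-spaces -/

/-- `I_q = {q^{-m} : m ∈ ℕ}`, where `ℕ = {1, 2, …}`. -/
def Iq (q : ℝ≥0) : Set ℝ≥0 := Set.range fun m : ℕ+ => (q ^ (m : ℕ))⁻¹

instance (q : ℝ≥0) : Countable (Iq q) := (Set.countable_range _).to_subtype

/-- `X_{q,k} = I_q^{k-1} × [0,∞)` (with `m = k - 1`). -/
abbrev X (q : ℝ≥0) (m : ℕ) : Type := (Fin m → Iq q) × ℝ≥0

/-- A `q`-invariant σ-finite Borel measure on `[0,∞)` for which `{0}` is a null set. -/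
structure QInvMeasure (q : ℝ≥0) where
  ν : Measure ℝ≥0
  sigmaFinite : SigmaFinite ν
  invariant : ∀ M : Set ℝ≥0, MeasurableSet M → ν ((fun t => q * t) '' M) = ν M
  zero_null : ν {0} = 0

variable {q : ℝ≥0}

instance (N : QInvMeasure q) : SigmaFinite N.ν := N.sigmaFinite

/-- `μ_k = δ ⊗ ⋯ ⊗ δ ⊗ ν` with the counting measure `δ` on `I_q` (and `m = k - 1`). -/
def mu (m : ℕ) (N : QInvMeasure q) : Measure (X q m) :=
  (Measure.pi fun _ : Fin m => (Measure.count : Measure (Iq q))).prod N.ν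

/-- `L²(X_{q,k}, μ_k)` (with `m = k - 1`) -/
abbrev L2 (m : ℕ) (N : QInvMeasure q) : Type := Lp ℂ 2 (mu m N)

/-- `t ↦ q t` on `I_q`; the value at `t = q⁻¹`, where `q t = 1 ∉ I_q`, is immaterial, as
it is only used multiplied by `√((q t)² - 1) = 0`. -/
def scaleIq (q : ℝ≥0) (t : Iq q) : Iq q :=
  open Classical in if h : q * (t : ℝ≥0) ∈ Iq q then ⟨q * t, h⟩ else t

/-- `(t_1, …, t_k) ↦ (t_1, …, q t_j, …, t_k)` -/
def scale (q : ℝ≥0) (m j : ℕ) (t : X q m) : X q m :=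
  if h : j < m then (Function.update t.1 ⟨j, h⟩ (scaleIq q (t.1 ⟨j, h⟩)), t.2)
  else if j = m then (t.1, q * t.2) else t

/-- `√((q t_j)² - 1) t_{j+1} ⋯ t_k` for `j < k`, `q t_k` for `j = k`, and `0` for `j > k`. -/
def coef (q : ℝ≥0) (m j : ℕ) (t : X q m) : ℝ :=
  if h : j < m then
    √(((q : ℝ) * ((t.1 ⟨j, h⟩ : ℝ≥0) : ℝ)) ^ 2 - 1) *
      ((∏ l ∈ Finset.univ.filter (fun l : Fin m => j < l), ((t.1 l : ℝ≥0) : ℝ)) * (t.2 : ℝ))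
  else if j = m then (q : ℝ) * (t.2 : ℝ) else 0

/-- `f` vanishes (almost everywhere) outside of `C`. -/
def VanishesOff {m : ℕ} {N : QInvMeasure q} (f : L2 m N) (C : Set (X q m)) : Prop :=
  ∀ᵐ t ∂(mu m N), t ∉ C → f t = 0

/-- `C` is a compact subset of `I_q^{k-1} × (0,∞)`. -/
def IsCompactPos {m : ℕ} (C : Set (X q m)) : Prop :=
  IsCompact C ∧ ∀ t ∈ C, 0 < t.2

/-- `D_k`: the functions in `L²(X_{q,k}, μ_k)` with compact support in `I_q^{k-1} × (0,∞)`. -/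
def compDomain (m : ℕ) (N : QInvMeasure q) : Submodule ℂ (L2 m N) where
  carrier := {f | ∃ C, IsCompactPos C ∧ VanishesOff f C}
  add_mem' := by
    rintro f g ⟨C, ⟨hC, hC'⟩, hf⟩ ⟨C₁, ⟨hC₁, hC₁'⟩, hg⟩
    refine ⟨C ∪ C₁, ⟨hC.union hC₁, ?_⟩, ?_⟩
    · rintro t (ht | ht)
      exacts [hC' t ht, hC₁' t ht]
    · filter_upwards [hf, hg, Lp.coeFn_add f g] with t h1 h2 h3 ht
      simp only [Set.mem_union, not_or] at ht
      rw [h3, Pi.add_apply, h1 ht.1, h2 ht.2, add_zero]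
  zero_mem' := by
    refine ⟨∅, ⟨isCompact_empty, by simp⟩, ?_⟩
    filter_upwards [Lp.coeFn_zero ℂ 2 (mu m N)] with t h _
    rw [h, Pi.zero_apply]
  smul_mem' := by
    rintro c f ⟨C, hC, hf⟩
    refine ⟨C, hC, ?_⟩
    filter_upwards [hf, Lp.coeFn_smul c f] with t h1 h2 ht
    simp [h2, h1 ht]

theorem quasi_scale_last (N : QInvMeasure q) :
    Measure.QuasiMeasurePreserving (fun t => q * t) N.ν N.ν := by
  have hm : Measurable (fun t : ℝ≥0 => q * t) := measurable_const_mul q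
  refine ⟨hm, Measure.AbsolutelyContinuous.mk fun s hs h => ?_⟩
  rw [Measure.map_apply hm hs, ← N.invariant _ (hm hs)]
  exact measure_mono_null (Set.image_preimage_subset _ _) h

theorem quasi_of_count {m : ℕ} (g : (Fin m → Iq q) → (Fin m → Iq q)) :
    Measure.QuasiMeasurePreserving g
      (Measure.pi fun _ : Fin m => (Measure.count : Measure (Iq q)))
      (Measure.pi fun _ : Fin m => (Measure.count : Measure (Iq q))) := by
  refine ⟨measurable_of_countable g, Measure.AbsolutelyContinuous.mk fun s hs h => ?_⟩
  have he : s = ∅ := by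
    by_contra hne
    obtain ⟨x, hx⟩ := Set.nonempty_iff_ne_empty.mpr hne
    have h1 : (Measure.pi fun _ : Fin m => (Measure.count : Measure (Iq q))) {x} = 0 :=
      measure_mono_null (Set.singleton_subset_iff.mpr hx) h
    rw [← Set.univ_pi_singleton, Measure.pi_pi] at h1
    simp at h1
  simp [he]

/-- The scaling maps preserve null sets, so that composition with them is well defined
on classes of functions. -/
theorem quasi_scale (m j : ℕ) (N : QInvMeasure q) :
    Measure.QuasiMeasurePreserving (scale q m j) (mu m N) (mu m N) := by
  unfold mu
  by_cases h : j < m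
  · have : scale q m j = Prod.map
        (fun s => Function.update s ⟨j, h⟩ (scaleIq q (s ⟨j, h⟩))) id := by
      funext t; simp [scale, h, Prod.map]
    rw [this]
    exact MeasureTheory.QuasiMeasurePreserving.prodMap (quasi_of_count _) (.id _)
  · by_cases h' : j = m
    · have : scale q m j = Prod.map id (fun t => q * t) := by
        funext t; simp [scale, h', Prod.map]
      rw [this]
      exact MeasureTheory.QuasiMeasurePreserving.prodMap (.id _) (quasi_scale_last N)
    · have : scale q m j = id := by
        funext t; simp [scale, h, h']
      rw [this]
      exact .id _

/-- `t ↦ coef t * h (scale t)` -/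
def opFun (m j : ℕ) (N : QInvMeasure q) (h : L2 m N) (t : X q m) : ℂ :=
  (coef q m j t : ℂ) * h (scale q m j t)

theorem opFun_add (m j : ℕ) (N : QInvMeasure q) (f g : L2 m N) :
    opFun m j N (f + g) =ᵐ[mu m N] opFun m j N f + opFun m j N g := by
  filter_upwards [(quasi_scale m j N).ae (Lp.coeFn_add f g)] with t ht
  simp only [opFun, Pi.add_apply] at ht ⊢
  rw [ht, mul_add]

theorem opFun_smul (m j : ℕ) (N : QInvMeasure q) (c : ℂ) (f : L2 m N) :
    opFun m j N (c • f) =ᵐ[mu m N] c • opFun m j N f := by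
  filter_upwards [(quasi_scale m j N).ae (Lp.coeFn_smul c f)] with t ht
  simp [opFun, ht, mul_left_comm]

theorem opFun_zero (m j : ℕ) (N : QInvMeasure q) :
    opFun m j N (0 : L2 m N) =ᵐ[mu m N] 0 := by
  filter_upwards [(quasi_scale m j N).ae (Lp.coeFn_zero ℂ 2 (mu m N))] with t ht
  rw [opFun, ht, Pi.zero_apply, mul_zero, Pi.zero_apply]

/-- The operator `(z_j h)(t) = coef t * h (t_1, …, q t_j, …, t_k)` on those `h ∈ D_k` for which
the right-hand side is in `L²`. -/
def concreteOp (m : ℕ) (N : QInvMeasure q) (j : ℕ) : L2 m N →ₗ.[ℂ] L2 m N where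
  domain :=
    { carrier := {h | h ∈ compDomain m N ∧ MemLp (opFun m j N h) 2 (mu m N)}
      add_mem' := fun {f g} hf hg =>
        ⟨(compDomain m N).add_mem hf.1 hg.1,
          (memLp_congr_ae (opFun_add m j N f g)).mpr (hf.2.add hg.2)⟩
      zero_mem' := ⟨(compDomain m N).zero_mem,
        (memLp_congr_ae (opFun_zero m j N)).mpr MemLp.zero⟩
      smul_mem' := fun c f hf =>
        ⟨(compDomain m N).smul_mem c hf.1,
          (memLp_congr_ae (opFun_smul m j N c f)).mpr (hf.2.const_smul c)⟩ }
  toFun :=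
    { toFun := fun h => MemLp.toLp (opFun m j N h.1) h.2.2
      map_add' := fun f g => by
        rw [← MemLp.toLp_add, MemLp.toLp_eq_toLp_iff]
        exact opFun_add m j N f.1 g.1
      map_smul' := fun c f => by
        rw [RingHom.id_apply, ← MemLp.toLp_const_smul, MemLp.toLp_eq_toLp_iff]
        exact opFun_smul m j N c f.1 }

end QPlane

end

/-! All the representations are one weighted shift in two guises. Let `A` be a symmetric operator on
`G`; on finitely supported families `Idx m →₀ G` let `z_j` raise the entry `i_j`, apply `A` and
multiply by `stdCoef`. The lowering shift with weights `lowerCoef` is formally adjoint to it. Since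
both involve the same `A`, every relation compares multiples of `A²` and reduces to an identity
between weights: the factors `q` come from the sum `i_{j+1} + ⋯ + i_k` in the exponent, and the last
relation from a telescoping sum of squared weights. A densely defined formal adjoint makes the
shifts closable and is contained in the adjoints of their closures (`isStarRep_of_shift`).

For part (a), `I_q^{k-1} × (0,∞)` is partitioned into the cells `t_l = q^{-i_l}` for `l < k`, `t_k =
q^{-i_k} x` with `x ∈ (q,1]`. By `q`-invariance of `ν` each cell is a copy of `(q,1]` with the
restriction of `ν`, so `L²(μ_k)` is a Hilbert sum of copies of `G = L²((q,1],ν)`. In these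
coordinates the concrete `z_j` is the weighted shift for which `A` is multiplication by `x`
(`opFun_cellMap`). Compact subsets of `I_q^{k-1} × (0,∞)` meet finitely many cells, and finitely
many cells lie in such a compact set; hence `D_k` consists of the finitely supported families
(`compDomain_eq_range`).

For part (b), the spectral theorem splits `A_k` into multiplications by the coordinate on spaces
`L²(σ)`, one for each cyclic subspace (`exists_cyclic_isometry`). Here `σ` lives on `[q,1]` and has
no atom at `q`, as `q` is not an eigenvalue; so it lives on the fundamental domain `(q,1]` of
multiplication by `q` and is the restriction of a `q`-invariant `ν` (`exists_qInvMeasure`). Both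
Hilbert spaces are now sums of the same spaces `L²((q,1],ν)`, indexed by `k`, a cyclic vector and a
multi-index, and `U` matches equal summands. It carries the elementary pairs whose closed span is
the graph of `z_j` on one side to those on the other (`intertwines_of_incl`), and finite sets of
multi-indices correspond to compact sets (`mem_stdDomain_iff_of_incl`). -/

noncomputable section

namespace QPlane

/-! ### Multi-indices and weights -/

section Indices

/-- The entry with number `l` of a multi-index, and `0` if there is no such entry. -/
def idxVal {m : ℕ} (i : Idx m) (l : ℕ) : ℤ :=
  if h : l < m then ((i.1 ⟨l, h⟩ : ℕ) : ℤ) else if l = m then i.2 else 0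

theorem idx_ext {m : ℕ} {i i' : Idx m} (h : ∀ l, idxVal i l = idxVal i' l) : i = i' := by
  refine Prod.ext (funext fun l => ?_) ?_
  · have := h l
    simpa [idxVal] using this
  · simpa [idxVal] using h m

theorem idxVal_pos {m : ℕ} (i : Idx m) {l : ℕ} (h : l < m) : 1 ≤ idxVal i l := by
  simp only [idxVal, h, dif_pos]
  exact_mod_cast (i.1 ⟨l, h⟩).2

theorem idxVal_raise {m : ℕ} (j : ℕ) (i : Idx m) (l : ℕ) :
    idxVal (raiseIdx m j i) l = idxVal i l + if l = j ∧ j ≤ m then 1 else 0 := by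
  by_cases hj : j < m
  · by_cases hl : l < m
    · by_cases hlj : l = j
      · subst hlj; simp [idxVal, raiseIdx, hj, hj.le]
      · simp [idxVal, raiseIdx, hj, hl, hlj]
    · have : l ≠ j := by omega
      simp [idxVal, raiseIdx, hj, hl, this]
  · by_cases hjm : j = m
    · subst hjm
      by_cases hl : l < j
      · simp [idxVal, raiseIdx, hl, hl.ne]
      · by_cases hlj : l = j <;> simp [idxVal, raiseIdx, hl, hlj]
    · have : ¬ j ≤ m := by omega
      simp [raiseIdx, hj, hjm, this]

/-- `(i_1, …, i_k) ↦ (i_1, …, i_j - 1, …, i_k)`, truncated at `i_j = 1` for `j < k`. -/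
def lowerIdx (m j : ℕ) (i : Idx m) : Idx m :=
  if h : j < m then (Function.update i.1 ⟨j, h⟩ (i.1 ⟨j, h⟩ - 1), i.2)
  else if j = m then (i.1, i.2 - 1) else i

theorem idxVal_lower {m : ℕ} (j : ℕ) (i : Idx m) (l : ℕ) :
    idxVal (lowerIdx m j i) l =
      idxVal i l - if l = j ∧ j ≤ m ∧ (j < m → 1 < idxVal i j) then 1 else 0 := by
  by_cases hj : j < m
  · by_cases hl : l < m
    · by_cases hlj : l = j
      · subst hlj
        have h1 := (i.1 ⟨l, hj⟩).2
        by_cases h2 : 1 < i.1 ⟨l, hj⟩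
        · have h3 : 1 < (i.1 ⟨l, hj⟩ : ℕ) := h2
          simp [idxVal, lowerIdx, hj, hj.le, PNat.sub_coe, h2]
          omega
        · have h4 : i.1 ⟨l, hj⟩ = 1 := le_antisymm (not_lt.mp h2) (one_le)
          simp [idxVal, lowerIdx, hj, PNat.sub_coe, h4]
      · simp [idxVal, lowerIdx, hj, hl, hlj]
    · have : l ≠ j := by omega
      simp [idxVal, lowerIdx, hj, hl, this]
  · by_cases hjm : j = m
    · subst hjm
      by_cases hl : l < j
      · simp [idxVal, lowerIdx, hl, hl.ne]
      · by_cases hlj : l = j <;> simp [idxVal, lowerIdx, hl, hlj]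
    · have : ¬ j ≤ m := by omega
      simp [lowerIdx, hj, hjm, this]

theorem raise_comm {m : ℕ} (j l : ℕ) (i : Idx m) :
    raiseIdx m j (raiseIdx m l i) = raiseIdx m l (raiseIdx m j i) :=
  idx_ext fun s => by simp only [idxVal_raise]; ring

theorem raise_lower_comm {m : ℕ} {j l : ℕ} (h : j ≠ l) (i : Idx m) :
    raiseIdx m j (lowerIdx m l i) = lowerIdx m l (raiseIdx m j i) :=
  idx_ext fun s => by
    have hl : ¬ (l = j ∧ j ≤ m) := fun hc => h hc.1.symm
    simp only [idxVal_raise, idxVal_lower, hl, if_false, add_zero]; ring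

theorem lower_raise {m : ℕ} (j : ℕ) (i : Idx m) : lowerIdx m j (raiseIdx m j i) = i :=
  idx_ext fun s => by
    rw [idxVal_lower, idxVal_raise, idxVal_raise]
    by_cases hj : j ≤ m
    · have : (j < m → 0 < idxVal i j) ↔ True :=
        iff_true_intro fun h => by have := idxVal_pos i h; omega
      by_cases hs : s = j <;> simp [hj, hs, this]
    · simp [hj]

theorem raise_lower {m : ℕ} {j : ℕ} {i : Idx m} (h : j < m → 1 < idxVal i j) :
    raiseIdx m j (lowerIdx m j i) = i :=
  idx_ext fun s => by
    rw [idxVal_raise, idxVal_lower]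
    by_cases hs : s = j
    · by_cases hj : j ≤ m
      · have h' : (j < m → 1 < idxVal i j) ↔ True := iff_true_intro h
        simp [hj, hs, h']
      · simp [hj]
    · simp [hs]

/-- `i_{j+1} + ⋯ + i_k` -/
def tailSum {m : ℕ} (i : Idx m) (j : ℕ) : ℤ := ∑ l ∈ Finset.Ioc j m, idxVal i l

theorem tailSum_eq {m : ℕ} (i : Idx m) {j : ℕ} (h : j < m) :
    tailSum i j = ∑ l ∈ Finset.univ.filter (fun l : Fin m => j < l), ((i.1 l : ℕ) : ℤ) + i.2 := by
  have h1 : Finset.Ioc j m = insert m (Finset.Ioo j m) := by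
    ext l; simp only [Finset.mem_Ioc, Finset.mem_insert, Finset.mem_Ioo]; omega
  rw [tailSum, h1, Finset.sum_insert (by simp), add_comm]
  congr 1
  · symm
    refine Finset.sum_bij (fun l _ => (l : ℕ)) ?_ ?_ ?_ ?_
    · intro l hl
      simpa using hl
    · intro a _ b _ hab
      exact Fin.ext hab
    · intro b hb
      rw [Finset.mem_Ioo] at hb
      exact ⟨⟨b, hb.2⟩, by simpa using hb.1, rfl⟩
    · intro l _
      simp [idxVal]
  · simp [idxVal]

theorem tailSum_raise {m : ℕ} (l : ℕ) (i : Idx m) (j : ℕ) :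
    tailSum (raiseIdx m l i) j = tailSum i j + if j < l ∧ l ≤ m then 1 else 0 := by
  simp only [tailSum, idxVal_raise, Finset.sum_add_distrib]
  congr 1
  by_cases h : l ≤ m <;> simp [h]

theorem tailSum_lower {m : ℕ} (l : ℕ) (i : Idx m) (j : ℕ) :
    tailSum (lowerIdx m l i) j =
      tailSum i j - if j < l ∧ l ≤ m ∧ (l < m → 1 < idxVal i l) then 1 else 0 := by
  simp only [tailSum, idxVal_lower, Finset.sum_sub_distrib]
  congr 1
  by_cases h : l ≤ m ∧ (l < m → 1 < idxVal i l)
  · simp only [iff_true_intro h]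
    simp [h.1]
  · simp only [h, and_false, if_false, Finset.sum_const_zero]

/-- The coefficient of the action of `z_j^*` on the component with multi-index `i`. -/
def lowerCoef (q : ℝ) (m j : ℕ) (i : Idx m) : ℝ :=
  if j < m then √(q ^ (-2 * (idxVal i j - 1)) - 1) * q ^ (-tailSum i j)
  else if j = m then q ^ (-(idxVal i j - 1)) else 0

theorem stdCoef_eq (q : ℝ) (m j : ℕ) (i : Idx m) :
    stdCoef q m j i = if j < m then √(q ^ (-2 * idxVal i j) - 1) * q ^ (-tailSum i j)
      else if j = m then q ^ (-idxVal i j) else 0 := by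
  by_cases h : j < m
  · simp only [stdCoef, h, dif_pos, if_true, tailSum_eq i h, idxVal]
  · by_cases h' : j = m
    · subst h'; simp [stdCoef, idxVal]
    · simp [stdCoef, h, h']

variable {q : ℝ} {m : ℕ}

theorem stdCoef_of_gt {j : ℕ} (h : m < j) (i : Idx m) : stdCoef q m j i = 0 := by
  rw [stdCoef_eq, if_neg h.not_gt, if_neg h.ne']

theorem lowerCoef_of_gt {j : ℕ} (h : m < j) (i : Idx m) : lowerCoef q m j i = 0 := by
  rw [lowerCoef, if_neg h.not_gt, if_neg h.ne']

theorem lowerCoef_raise {j : ℕ} (i : Idx m) :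
    lowerCoef q m j (raiseIdx m j i) = stdCoef q m j i := by
  rcases lt_or_ge m j with h | h
  · rw [stdCoef_of_gt h, lowerCoef_of_gt h]
  · rw [lowerCoef, stdCoef_eq, idxVal_raise, tailSum_raise]
    simp [h]

/-- At `i_j = 1` the root is `√(q^0 - 1) = 0`. Hence the truncated value of `lowerIdx` is always
multiplied by zero and never matters. -/
theorem lowerCoef_of_not {j : ℕ} {i : Idx m} (h : ¬ (j < m → 1 < idxVal i j)) :
    lowerCoef q m j i = 0 := by
  have h1 : j < m := by tauto
  have h2 : idxVal i j = 1 := le_antisymm (not_lt.mp fun h3 => h fun _ => h3) (idxVal_pos i h1)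
  simp [lowerCoef, h1, h2]

theorem stdCoef_lower {j : ℕ} {i : Idx m} (h : j < m → 1 < idxVal i j) :
    stdCoef q m j (lowerIdx m j i) = lowerCoef q m j i := by
  rw [← lowerCoef_raise, raise_lower h]

/-- Raising `i_l` for `l < j` does not change the weight of `z_j`. -/
theorem stdCoef_raise_of_lt {j l : ℕ} (h : l < j) (i : Idx m) :
    stdCoef q m j (raiseIdx m l i) = stdCoef q m j i := by
  simp [stdCoef_eq, idxVal_raise, tailSum_raise, h.ne', h.not_gt]

theorem lowerCoef_raise_of_lt {j l : ℕ} (h : l < j) (i : Idx m) :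
    lowerCoef q m j (raiseIdx m l i) = lowerCoef q m j i := by
  simp [lowerCoef, idxVal_raise, tailSum_raise, h.ne', h.not_gt]

theorem stdCoef_lower_of_lt {j l : ℕ} (h : l < j) (i : Idx m) :
    stdCoef q m j (lowerIdx m l i) = stdCoef q m j i := by
  simp [stdCoef_eq, idxVal_lower, tailSum_lower, h.ne', h.not_gt]

/-- The entry `i_l` with `l > j` enters the weight of `z_j` only through the tail sum, so raising it
costs a factor `q⁻¹`. This is the source of the factor `q` in the commutation relations. -/
theorem stdCoef_raise_of_gt (hq : q ≠ 0) {j l : ℕ} (h : j < l) (hl : l ≤ m) (i : Idx m) :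
    q * stdCoef q m j (raiseIdx m l i) = stdCoef q m j i := by
  have hj : j < m := h.trans_le hl
  simp only [stdCoef_eq, idxVal_raise, tailSum_raise, h.ne, h, hl, hj, false_and, if_false,
    true_and, if_true, add_zero, neg_add]
  rw [zpow_add₀ hq, zpow_neg_one]
  field_simp

theorem lowerCoef_raise_of_gt (hq : q ≠ 0) {j l : ℕ} (h : j < l) (hl : l ≤ m) (i : Idx m) :
    q * lowerCoef q m j (raiseIdx m l i) = lowerCoef q m j i := by
  have hj : j < m := h.trans_le hl
  simp only [lowerCoef, idxVal_raise, tailSum_raise, h.ne, h, hl, hj, false_and, if_false,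
    true_and, if_true, add_zero, neg_add]
  rw [zpow_add₀ hq, zpow_neg_one]
  field_simp

theorem stdCoef_lower_of_gt (hq : q ≠ 0) {j l : ℕ} (h : j < l) (hl : l ≤ m) {i : Idx m}
    (hi : l < m → 1 < idxVal i l) :
    stdCoef q m j (lowerIdx m l i) = q * stdCoef q m j i := by
  rw [← stdCoef_raise_of_gt hq h hl, raise_lower hi]

theorem stdCoef_mul_raise (hq : q ≠ 0) {j l : ℕ} (h : l < j) (i : Idx m) :
    stdCoef q m j (raiseIdx m l i) * stdCoef q m l i =
      q * (stdCoef q m l (raiseIdx m j i) * stdCoef q m j i) := by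
  rcases lt_or_ge m j with hj | hj
  · simp [stdCoef_of_gt hj]
  · rw [stdCoef_raise_of_lt h, ← mul_assoc, stdCoef_raise_of_gt hq h hj, mul_comm]

theorem stdCoef_mul_lower (hq : q ≠ 0) {j l : ℕ} (h : l ≠ j) (i : Idx m) :
    stdCoef q m j (lowerIdx m l i) * lowerCoef q m l i =
      q * (lowerCoef q m l (raiseIdx m j i) * stdCoef q m j i) := by
  rcases lt_or_ge m j with hj | hj
  · simp [stdCoef_of_gt hj]
  rcases lt_or_gt_of_ne h with h | h
  · rw [stdCoef_lower_of_lt h, ← mul_assoc, lowerCoef_raise_of_gt hq h hj, mul_comm]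
  · rw [lowerCoef_raise_of_lt h]
    rcases lt_or_ge m l with hl | hl
    · simp [lowerCoef_of_gt hl]
    by_cases hi : l < m → 1 < idxVal i l
    · rw [stdCoef_lower_of_gt hq h hl hi]; ring
    · simp [lowerCoef_of_not hi]

theorem one_le_zpow_neg (hq0 : 0 < q) (hq1 : q < 1) {a : ℤ} (ha : 0 ≤ a) :
    1 ≤ q ^ (-2 * a) := by
  have : -2 * a = -(2 * a) := by ring
  rw [this, zpow_neg, ← inv_zpow]
  exact one_le_zpow₀ ((one_le_inv₀ hq0).mpr hq1.le) (by omega)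

theorem stdCoef_sq (hq0 : 0 < q) (hq1 : q < 1) {j : ℕ} (h : j < m) (i : Idx m) :
    stdCoef q m j i ^ 2 = (q ^ (-2 * idxVal i j) - 1) * q ^ (-2 * tailSum i j) := by
  rw [stdCoef_eq, if_pos h, mul_pow, Real.sq_sqrt, ← zpow_natCast, ← zpow_mul]
  · congr 2; push_cast; ring
  · exact sub_nonneg.mpr (one_le_zpow_neg hq0 hq1 (by have := idxVal_pos i h; omega))

theorem lowerCoef_sq (hq0 : 0 < q) (hq1 : q < 1) {j : ℕ} (h : j < m) (i : Idx m) :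
    lowerCoef q m j i ^ 2 = (q ^ (-2 * (idxVal i j - 1)) - 1) * q ^ (-2 * tailSum i j) := by
  rw [lowerCoef, if_pos h, mul_pow, Real.sq_sqrt, ← zpow_natCast, ← zpow_mul]
  · congr 2; push_cast; ring
  · exact sub_nonneg.mpr (one_le_zpow_neg hq0 hq1 (by have := idxVal_pos i h; omega))

theorem tailSum_pred {j : ℕ} (h : j < m) (i : Idx m) :
    tailSum i j = idxVal i (j + 1) + tailSum i (j + 1) := by
  have : Finset.Ioc j m = insert (j + 1) (Finset.Ioc (j + 1) m) := by
    ext l; simp only [Finset.mem_Ioc, Finset.mem_insert]; omega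
  rw [tailSum, this, Finset.sum_insert (by simp)]
  rfl

/-- The sum telescopes: by `stdCoef_sq` the term of index `j + 1 < m` is `q^(-2 * tailSum i j) -
q^(-2 * tailSum i (j + 1))`, and the last one, of index `m`, is the full power. The induction runs
downwards from `j + 1 = m`. -/
theorem sum_stdCoef_sq_aux (hq0 : 0 < q) (hq1 : q < 1) (i : Idx m) (d : ℕ) :
    ∀ j, j + 1 + d = m →
      ∑ l ∈ Finset.Ioc j m, stdCoef q m l i ^ 2 = q ^ (-2 * tailSum i j) := by
  induction d with
  | zero =>
    intro j hj
    have hj' : j + 1 = m := by omega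
    subst hj'
    rw [tailSum_pred (Nat.lt_succ_self j)]
    simp [stdCoef_eq, tailSum]
    rw [← zpow_natCast, ← zpow_mul]
    congr 1; push_cast; ring
  | succ d ih =>
    intro j hj
    have : Finset.Ioc j m = insert (j + 1) (Finset.Ioc (j + 1) m) := by
      ext l; simp only [Finset.mem_Ioc, Finset.mem_insert]; omega
    rw [this, Finset.sum_insert (by simp), ih (j + 1) (by omega),
      stdCoef_sq hq0 hq1 (by omega), tailSum_pred (by omega : j < m), mul_add,
      zpow_add₀ hq0.ne']
    ring

theorem sum_stdCoef_sq (hq0 : 0 < q) (hq1 : q < 1) {n : ℕ} (hn : m < n) {j : ℕ} (hj : j < m)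
    (i : Idx m) :
    ∑ l ∈ Finset.univ.filter (fun l : Fin n => j < l), stdCoef q m l i ^ 2 =
      q ^ (-2 * tailSum i j) := by
  rw [← sum_stdCoef_sq_aux hq0 hq1 i (m - (j + 1)) j (by omega)]
  have h1 : ∑ l ∈ Finset.univ.filter (fun l : Fin n => j < l), stdCoef q m l i ^ 2 =
      ∑ l ∈ Finset.Ioo j n, stdCoef q m l i ^ 2 := by
    refine Finset.sum_bij (fun l _ => (l : ℕ)) ?_ ?_ ?_ ?_
    · intro l hl
      simpa using hl
    · intro a _ b _ hab
      exact Fin.ext hab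
    · intro b hb
      rw [Finset.mem_Ioo] at hb
      exact ⟨⟨b, hb.2⟩, by simpa using hb.1, rfl⟩
    · intro l _
      rfl
  rw [h1]
  symm
  refine Finset.sum_subset ?_ ?_
  · intro l; simp only [Finset.mem_Ioc, Finset.mem_Ioo]; omega
  · intro l hl hl'
    simp only [Finset.mem_Ioc, Finset.mem_Ioo] at hl hl'
    rw [stdCoef_of_gt (by omega)]; simp

/-- The scalar form of the relation for `z_i z_i^*`. For `j < m`, after removing the common power of
`q`, it says `q^(2-2a) - 1 = q^2 (q^(-2a) - 1) - (1 - q^2)` with `a = i_j`; for `j ≥ m` the sum on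
the right vanishes. -/
theorem lowerCoef_sq_eq (hq0 : 0 < q) (hq1 : q < 1) {n : ℕ} (hn : m < n) (j : Fin n)
    (i : Idx m) :
    lowerCoef q m j i ^ 2 = q ^ 2 * stdCoef q m j i ^ 2 -
      (1 - q ^ 2) * ∑ l ∈ Finset.univ.filter (fun l : Fin n => j < l), stdCoef q m l i ^ 2 := by
  rcases lt_or_ge (j : ℕ) m with h | h
  · have hs := sum_stdCoef_sq hq0 hq1 hn h i
    simp only [Fin.val_fin_lt] at hs
    rw [hs, stdCoef_sq hq0 hq1 h, lowerCoef_sq hq0 hq1 h,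
      show -2 * (idxVal i j - 1) = -2 * idxVal i j + 2 by ring, zpow_add₀ hq0.ne',
      show q ^ (2 : ℤ) = q ^ 2 from zpow_natCast q 2]
    ring
  · rw [Finset.sum_eq_zero]
    · rcases h.eq_or_lt with h | h
      · rw [stdCoef_eq, lowerCoef, ← h]
        simp only [lt_irrefl, if_false, if_true]
        rw [neg_sub, sub_eq_add_neg, zpow_add₀ hq0.ne', zpow_one]
        ring
      · simp [stdCoef_of_gt h, lowerCoef_of_gt h]
    · intro l hl
      have : (j : ℕ) < l := by simpa using hl
      rw [stdCoef_of_gt (by omega)]; simp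

end Indices

/-! ### Weighted shifts on finitely supported families -/

section Shifts

variable {G : Type u} [NormedAddCommGroup G] [InnerProductSpace ℂ G]

/-- The weighted shift `g_i ↦ stdCoef i • (A g)_{raiseIdx i}` on finitely supported families. -/
def raiseShift (q : ℝ) (m : ℕ) (A : G →ₗ[ℂ] G) (j : ℕ) : Module.End ℂ (Idx m →₀ G) :=
  Finsupp.lsum ℂ fun i => Finsupp.lsingle (raiseIdx m j i) ∘ₗ ((stdCoef q m j i : ℂ) • A)

/-- The weighted shift `g_i ↦ lowerCoef i • (A g)_{lowerIdx i}` on finitely supported families. -/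
def lowerShift (q : ℝ) (m : ℕ) (A : G →ₗ[ℂ] G) (j : ℕ) : Module.End ℂ (Idx m →₀ G) :=
  Finsupp.lsum ℂ fun i => Finsupp.lsingle (lowerIdx m j i) ∘ₗ ((lowerCoef q m j i : ℂ) • A)

variable {q : ℝ} {m : ℕ} {A : G →ₗ[ℂ] G}

@[simp]
theorem raiseShift_single (j : ℕ) (i : Idx m) (g : G) :
    raiseShift q m A j (Finsupp.single i g) =
      Finsupp.single (raiseIdx m j i) ((stdCoef q m j i : ℂ) • A g) := by
  simp [raiseShift]

@[simp]
theorem lowerShift_single (j : ℕ) (i : Idx m) (g : G) :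
    lowerShift q m A j (Finsupp.single i g) =
      Finsupp.single (lowerIdx m j i) ((lowerCoef q m j i : ℂ) • A g) := by
  simp [lowerShift]

theorem raiseShift_mul_raiseShift (hq : q ≠ 0) {i j : ℕ} (h : i < j) :
    raiseShift q m A j * raiseShift q m A i =
      (q : ℂ) • (raiseShift q m A i * raiseShift q m A j) := by
  refine Finsupp.lhom_ext fun p g => ?_
  simp only [Module.End.mul_apply, LinearMap.smul_apply, raiseShift_single, Finsupp.smul_single,
    map_smul, smul_smul, raise_comm j i p]
  have := stdCoef_mul_raise (q := q) hq h p
  congr 2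
  exact_mod_cast this

theorem raiseShift_mul_lowerShift (hq : q ≠ 0) {i j : ℕ} (h : i ≠ j) :
    raiseShift q m A j * lowerShift q m A i =
      (q : ℂ) • (lowerShift q m A i * raiseShift q m A j) := by
  refine Finsupp.lhom_ext fun p g => ?_
  simp only [Module.End.mul_apply, LinearMap.smul_apply, raiseShift_single, lowerShift_single,
    Finsupp.smul_single, map_smul, smul_smul, raise_lower_comm h.symm p]
  have := stdCoef_mul_lower (q := q) hq h p
  congr 2
  exact_mod_cast this

theorem raiseShift_mul_lowerShift_single (j : ℕ) (p : Idx m) (g : G) :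
    raiseShift q m A j (lowerShift q m A j (Finsupp.single p g)) =
      Finsupp.single p ((lowerCoef q m j p ^ 2 : ℂ) • A (A g)) := by
  rw [lowerShift_single, raiseShift_single, map_smul, smul_smul]
  by_cases h : j < m → 1 < idxVal p j
  · rw [raise_lower h, stdCoef_lower h, sq]
  · simp [lowerCoef_of_not h]

theorem lowerShift_mul_raiseShift_single (j : ℕ) (p : Idx m) (g : G) :
    lowerShift q m A j (raiseShift q m A j (Finsupp.single p g)) =
      Finsupp.single p ((stdCoef q m j p ^ 2 : ℂ) • A (A g)) := by
  rw [raiseShift_single, lowerShift_single, map_smul, smul_smul, lowerCoef_raise, lower_raise, sq]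

theorem raiseShift_mul_lowerShift_self (hq0 : 0 < q) (hq1 : q < 1) {n : ℕ} (hn : m < n)
    (i : Fin n) :
    raiseShift q m A i * lowerShift q m A i =
      ((q : ℂ) ^ 2) • (lowerShift q m A i * raiseShift q m A i) -
      (1 - (q : ℂ) ^ 2) • ∑ j ∈ Finset.univ.filter (fun j => i < j),
        lowerShift q m A (j : Fin n) * raiseShift q m A (j : Fin n) := by
  refine Finsupp.lhom_ext fun p g => ?_
  simp only [Module.End.mul_apply, LinearMap.smul_apply, LinearMap.sub_apply, LinearMap.sum_apply,
    lowerShift_mul_raiseShift_single, raiseShift_mul_lowerShift_single, Finsupp.smul_single]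
  rw [← Finsupp.single_finsetSum, ← Finset.sum_smul, Finsupp.smul_single, ← Finsupp.single_sub,
    smul_smul, smul_smul, ← sub_smul]
  congr 2
  have := lowerCoef_sq_eq hq0 hq1 hn i p
  exact_mod_cast this

variable {E : Type v} [NormedAddCommGroup E] [InnerProductSpace ℂ E] {V : Idx m → G →ₗᵢ[ℂ] E}

/-- The map `∑ g_i ↦ ∑ V i g_i` on finitely supported families. -/
def sumMap (V : Idx m → G →ₗᵢ[ℂ] E) : (Idx m →₀ G) →ₗ[ℂ] E :=
  Finsupp.lsum ℂ fun i => (V i).toLinearMap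

@[simp]
theorem sumMap_single (i : Idx m) (g : G) : sumMap V (Finsupp.single i g) = V i g := by
  simp [sumMap]

theorem inner_sumMap (hV : OrthogonalFamily ℂ (fun _ => G) V) (i : Idx m) (g : G)
    (p : Idx m →₀ G) : inner ℂ (V i g) (sumMap V p) = inner ℂ g (p i) := by
  induction p using Finsupp.induction_linear with
  | zero => simp
  | add p p' h h' => rw [map_add, inner_add_right, h, h', Finsupp.add_apply, inner_add_right]
  | single i' g' =>
    rw [sumMap_single]
    by_cases h : i = i'
    · subst h; simp
    · rw [hV h, Finsupp.single_eq_of_ne h, inner_zero_right]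

theorem sumMap_injective (hV : OrthogonalFamily ℂ (fun _ => G) V) :
    Function.Injective (sumMap V) := by
  rw [← LinearMap.ker_eq_bot, LinearMap.ker_eq_bot']
  intro p hp
  ext i
  have := inner_sumMap hV i (p i) p
  rw [hp, inner_zero_right] at this
  simpa using this.symm

/-- On families with a single entry both sides vanish unless `i' = raiseIdx m j i`; in that case
`lowerCoef_raise` makes the weights agree and `A` is moved across by symmetry. -/
theorem inner_raiseShift (hV : OrthogonalFamily ℂ (fun _ => G) V)
    (hA : ∀ g g', inner ℂ (A g) g' = inner ℂ g (A g')) (j : ℕ) (p p' : Idx m →₀ G) :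
    inner ℂ (sumMap V (raiseShift q m A j p)) (sumMap V p') =
      inner ℂ (sumMap V p) (sumMap V (lowerShift q m A j p')) := by
  induction p using Finsupp.induction_linear with
  | zero => simp
  | add x y h h' => simp only [map_add, inner_add_left, h, h']
  | single i g =>
    induction p' using Finsupp.induction_linear with
    | zero => simp
    | add x y h h' => simp only [map_add, inner_add_right, h, h']
    | single i' g' =>
      simp only [raiseShift_single, lowerShift_single, sumMap_single, map_smul]
      rw [inner_smul_left, inner_smul_right, Complex.conj_ofReal]
      by_cases h : raiseIdx m j i = i'
      · subst h
        rw [lower_raise, lowerCoef_raise, LinearIsometry.inner_map_map,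
          LinearIsometry.inner_map_map, hA]
      · rw [hV h, mul_zero]
        -- If the lowering is truncated, the index `lowerIdx m j i'` may coincide with `i`, but then
        -- the weight is zero.
        by_cases h' : j < m → 1 < idxVal i' j
        · have : i ≠ lowerIdx m j i' := fun hc => h (hc ▸ raise_lower h')
          rw [hV this, mul_zero]
        · simp [lowerCoef_of_not h']

/-- The abstract core of both parts: `V` embeds the components orthogonally, and `T j` acts on
finite sums as the raising shift. The operator `S j` below, the lowering shift on the same domain,
is a densely defined formal adjoint; this yields closability and the action of the adjoints on `D`.
The relations are then transported from finitely supported families. -/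
theorem isStarRep_of_shift [CompleteSpace E] (hq0 : 0 < q) (hq1 : q < 1) {n : ℕ} (hn : m < n)
    (hV : OrthogonalFamily ℂ (fun _ => G) V)
    (hA : ∀ g g', inner ℂ (A g) g' = inner ℂ g (A g')) {D : Submodule ℂ E}
    (hD : D = LinearMap.range (sumMap V)) (hdense : Dense (D : Set E))
    (T : Fin n → E →ₗ.[ℂ] E) (hdom : ∀ j, (T j).domain = D)
    (hT : ∀ (j : Fin n) (p : Idx m →₀ G),
      (sumMap V p, sumMap V (raiseShift q m A j p)) ∈ (T j).graph) :
    (∀ j, (T j).IsClosable) ∧ IsStarRep q D (fun j => (T j).closure) := by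
  subst hD
  let e : (Idx m →₀ G) ≃ₗ[ℂ] LinearMap.range (sumMap V) :=
    LinearEquiv.ofInjective _ (sumMap_injective hV)
  have he : ∀ p, (e p : E) = sumMap V p := fun p => rfl
  let S : Fin n → E →ₗ.[ℂ] E := fun j =>
    ⟨LinearMap.range (sumMap V), sumMap V ∘ₗ lowerShift q m A j ∘ₗ e.symm.toLinearMap⟩
  have hadj : ∀ j, (T j).IsFormalAdjoint (S j) := by
    rintro j ⟨x, hx⟩ ⟨_, p', rfl⟩
    obtain ⟨p, rfl⟩ : x ∈ LinearMap.range (sumMap V) := hdom j ▸ hx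
    have h1 : T j ⟨sumMap V p, hx⟩ = sumMap V (raiseShift q m A j p) :=
      ((T j).image_iff hx).mpr (hT j p) |>.symm
    have h2 : e.symm ⟨sumMap V p', p', rfl⟩ = p' := by
      rw [LinearEquiv.symm_apply_eq]; rfl
    change inner ℂ _ (sumMap V p') = inner ℂ (sumMap V p) (sumMap V (lowerShift q m A j _))
    rw [h1, LinearEquiv.coe_coe, h2, inner_raiseShift hV hA]
  have hSdense : ∀ j, Dense ((S j).domain : Set E) := fun j => hdense
  have hle : ∀ j, T j ≤ (S j)† := fun j => (hadj j).symm.le_adjoint (hSdense j)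
  have hclosable : ∀ j, (T j).IsClosable := fun j =>
    LinearPMap.isClosable_iff_exists_closed_extension.mpr
      ⟨_, LinearPMap.adjoint_isClosed (hSdense j), hle j⟩
  -- The adjoint of `S j` is a closed extension of `T j`, so it also extends the closure. This keeps
  -- `S j` formally adjoint to the closure, not only to `T j`.
  have hle' : ∀ j, (T j).closure ≤ (S j)† := by
    intro j
    refine LinearPMap.le_of_le_graph ?_
    rw [← (hclosable j).graph_closure_eq_closure_graph]
    exact Submodule.topologicalClosure_minimal _ (LinearPMap.le_graph_of_le (hle j))
      (LinearPMap.adjoint_isClosed (hSdense j))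
  have hTdense : ∀ j, Dense ((T j).closure.domain : Set E) := fun j =>
    hdense.mono ((hdom j).symm.le.trans (T j).le_closure.1)
  have hS : ∀ j, S j ≤ ((T j).closure)† := by
    intro j
    refine LinearPMap.IsFormalAdjoint.le_adjoint (hTdense j) ?_
    intro x y
    rw [(hle' j).2 (x := x) (y := ⟨x, (hle' j).1 x.2⟩) rfl]
    exact LinearPMap.adjoint_isFormalAdjoint (hSdense j) _ y
  have hmul : ∀ f g : Module.End ℂ (Idx m →₀ G), e.conj (f * g) = e.conj f * e.conj g :=
    fun f g => LinearEquiv.conj_comp e g f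
  refine ⟨hclosable, hdense, fun j => (hclosable j).closure_isClosed, fun j => ?_, ?_⟩
  · rw [← hdom j]
    exact (T j).closureHasCore
  · refine ⟨fun j => e.conj (raiseShift q m A j), fun j => e.conj (lowerShift q m A j),
      ?_, ?_, ?_, ?_, ?_⟩
    · intro j x
      obtain ⟨p, rfl⟩ := e.surjective x
      refine LinearPMap.le_graph_of_le (T j).le_closure ?_
      rw [LinearEquiv.conj_apply_apply, LinearEquiv.symm_apply_apply]
      exact hT j p
    · intro j x
      refine LinearPMap.le_graph_of_le (hS j) ?_
      rw [LinearPMap.mem_graph_iff]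
      exact ⟨x, rfl, rfl⟩
    · intro i j h
      rw [← hmul, raiseShift_mul_raiseShift hq0.ne' (Fin.lt_def.mp h), map_smul,
        hmul]
    · intro i j h
      rw [← hmul, raiseShift_mul_lowerShift hq0.ne' (Fin.val_ne_of_ne h),
        map_smul, hmul]
    · intro i
      rw [← hmul, raiseShift_mul_lowerShift_self hq0 hq1 hn, map_sub, map_smul,
        map_smul, map_sum]
      simp only [hmul]

end Shifts

/-! ### Multiplication by the coordinate -/

section Multiplication

/-- Truncating the coordinate at `1` gives a bounded multiplication operator for every `σ`. The
measures to which it is applied live on `[q, 1]`, where `min x 1 = x`. -/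
theorem memLp_min_one_mul {σ : Measure ℝ≥0} (g : Lp ℂ 2 σ) :
    MemLp (fun x => ((min x 1 : ℝ≥0) : ℂ) * g x) 2 σ := by
  refine (Lp.memLp g).of_le ?_ (Eventually.of_forall fun x => ?_)
  · refine AEStronglyMeasurable.mul ?_ (Lp.aestronglyMeasurable g)
    have : Continuous fun x : ℝ≥0 => (((min x 1 : ℝ≥0) : ℝ) : ℂ) := by fun_prop
    exact this.aestronglyMeasurable
  · rw [norm_mul]
    refine mul_le_of_le_one_left (norm_nonneg _) ?_
    have : ‖(((min x 1 : ℝ≥0) : ℝ) : ℂ)‖ = ((min x 1 : ℝ≥0) : ℝ) := by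
      rw [Complex.norm_real, Real.norm_of_nonneg (NNReal.coe_nonneg _)]
    exact this.le.trans (by exact_mod_cast min_le_right x 1)

/-- Multiplication by `x ↦ min x 1` on `L²(σ)`. -/
def mulOp (σ : Measure ℝ≥0) : Lp ℂ 2 σ →L[ℂ] Lp ℂ 2 σ :=
  LinearMap.mkContinuous
    { toFun := fun g => (memLp_min_one_mul g).toLp
      map_add' := fun f g => by
        rw [← MemLp.toLp_add, MemLp.toLp_eq_toLp_iff]
        filter_upwards [Lp.coeFn_add f g] with x hx
        rw [hx, Pi.add_apply, Pi.add_apply, mul_add]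
      map_smul' := fun c f => by
        rw [RingHom.id_apply, ← MemLp.toLp_const_smul, MemLp.toLp_eq_toLp_iff]
        filter_upwards [Lp.coeFn_smul c f] with x hx
        simp [hx, mul_left_comm] } 1 (by
    intro g
    rw [one_mul]
    refine Lp.norm_le_norm_of_ae_le ?_
    filter_upwards [(memLp_min_one_mul g).coeFn_toLp] with x hx
    change ‖(memLp_min_one_mul g).toLp _ x‖ ≤ _
    rw [hx, norm_mul]
    refine mul_le_of_le_one_left (norm_nonneg _) ?_
    have : ‖(((min x 1 : ℝ≥0) : ℝ) : ℂ)‖ = ((min x 1 : ℝ≥0) : ℝ) := by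
      rw [Complex.norm_real, Real.norm_of_nonneg (NNReal.coe_nonneg _)]
    exact this.le.trans (by exact_mod_cast min_le_right x 1))

theorem mulOp_coe {σ : Measure ℝ≥0} (g : Lp ℂ 2 σ) :
    mulOp σ g =ᵐ[σ] fun x => ((min x 1 : ℝ≥0) : ℂ) * g x :=
  (memLp_min_one_mul g).coeFn_toLp

theorem inner_mulOp {σ : Measure ℝ≥0} (f g : Lp ℂ 2 σ) :
    inner ℂ (mulOp σ f) g = inner ℂ f (mulOp σ g) := by
  rw [L2.inner_def, L2.inner_def]
  refine integral_congr_ae ?_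
  filter_upwards [mulOp_coe f, mulOp_coe g] with x hf hg
  rw [hf, hg]
  simp only [RCLike.inner_apply, map_mul, Complex.conj_ofReal]
  ring

end Multiplication

/-! ### Cells of `X q m` -/

section Cells

variable {q : ℝ≥0}

/-- `a ↦ q^{-a}` -/
def powIq (q : ℝ≥0) (a : ℕ+) : Iq q := ⟨(q ^ (a : ℕ))⁻¹, a, rfl⟩

theorem powIq_surjective : Function.Surjective (powIq q) := by
  rintro ⟨_, a, rfl⟩
  exact ⟨a, rfl⟩

theorem powIq_injective (hq0 : 0 < q) (hq1 : q < 1) : Function.Injective (powIq q) := by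
  intro a b h
  have h1 : q ^ (a : ℕ) = q ^ (b : ℕ) := inv_injective (Subtype.ext_iff.mp h)
  exact PNat.coe_injective (pow_right_injective₀ hq0 hq1.ne h1)

/-- The set of the `t` with `t_l = q^{-i_l}` for `l < k` and `t_k ∈ (q^{1-i_k}, q^{-i_k}]`. -/
def cellSet (q : ℝ≥0) {m : ℕ} (i : Idx m) : Set (X q m) :=
  {fun l => powIq q (i.1 l)} ×ˢ ((fun s => q ^ i.2 * s) ⁻¹' Set.Ioc q 1)

theorem mem_cellSet {m : ℕ} {i : Idx m} {t : X q m} :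
    t ∈ cellSet q i ↔ (t.1 = fun l => powIq q (i.1 l)) ∧ q < q ^ i.2 * t.2 ∧ q ^ i.2 * t.2 ≤ 1 :=
  Iff.rfl

/-- The interval `(q, 1]` is a fundamental domain of multiplication by `q`: for `d ≥ 1` and `x ≤ 1`
one has `q ^ d * x ≤ q`. Negative `d` follows by exchanging `x` and `q ^ d * x`. -/
theorem zpow_eq_zero_of_mem_Ioc (hq0 : 0 < q) (hq1 : q < 1) {x : ℝ≥0} {d : ℤ}
    (hx : x ∈ Set.Ioc q 1) (hd : q ^ d * x ∈ Set.Ioc q 1) : d = 0 := by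
  have key : ∀ {x : ℝ≥0} {d : ℤ}, x ∈ Set.Ioc q 1 → q ^ d * x ∈ Set.Ioc q 1 → d ≤ 0 := by
    intro x d hx hd
    by_contra! hc
    have h1 : q ^ d ≤ q := by
      conv_rhs => rw [← zpow_one q]
      exact zpow_le_zpow_right_of_le_one₀ hq0 hq1.le (by omega)
    exact (hd.1.trans_le ((mul_le_mul' h1 hx.2).trans_eq (mul_one q))).false
  refine le_antisymm (key hx hd) ?_
  have := key hd (d := -d) (by rwa [← mul_assoc, ← zpow_add₀ hq0.ne', neg_add_cancel, zpow_zero,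
    one_mul])
  omega

theorem cellSet_inj (hq0 : 0 < q) (hq1 : q < 1) {m : ℕ} {i i' : Idx m} {t : X q m}
    (h : t ∈ cellSet q i) (h' : t ∈ cellSet q i') : i = i' := by
  refine Prod.ext (funext fun l => ?_) ?_
  · exact powIq_injective hq0 hq1 (congrFun (h.1.symm.trans h'.1) l)
  · have : q ^ (i'.2 - i.2) * (q ^ i.2 * t.2) ∈ Set.Ioc q 1 := by
      rw [← mul_assoc, ← zpow_add₀ hq0.ne', sub_add_cancel]
      exact h'.2
    have := zpow_eq_zero_of_mem_Ioc hq0 hq1 h.2 this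
    omega

theorem exists_mem_cellSet (hq0 : 0 < q) (hq1 : q < 1) {m : ℕ} (t : X q m) (ht : t.2 ≠ 0) :
    ∃ i, t ∈ cellSet q i := by
  choose a ha using fun l => powIq_surjective (t.1 l)
  obtain ⟨k, hk⟩ := NNReal.exists_mem_Ioc_zpow ht ((one_lt_inv₀ hq0).mpr hq1)
  -- The choice of `k` gives `q^(-k) < t_k ≤ q^(-k-1)`, so it is `q^(k+1)` that brings `t_k` into
  -- `(q, 1]`.
  refine ⟨(a, k + 1), mem_cellSet.mpr ⟨funext fun l => (ha l).symm, ?_, ?_⟩⟩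
  · have h1 : q = q ^ (k + 1) * (q⁻¹) ^ k := by
      rw [inv_zpow, zpow_add₀ hq0.ne', zpow_one, mul_comm (q ^ k), mul_assoc,
        mul_inv_cancel₀ (zpow_ne_zero _ hq0.ne'), mul_one]
    conv_lhs => rw [h1]
    exact mul_lt_mul_of_pos_left hk.1 (zpow_pos hq0 _)
  · have h1 : 1 = q ^ (k + 1) * (q⁻¹) ^ (k + 1) := by
      rw [inv_zpow, mul_inv_cancel₀ (zpow_ne_zero _ hq0.ne')]
    conv_rhs => rw [h1]
    exact mul_le_mul_of_nonneg_left hk.2 zero_le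

theorem measurableSet_cellSet {m : ℕ} (i : Idx m) : MeasurableSet (cellSet q i) :=
  (MeasurableSet.singleton _).prod (measurableSet_Ioc.preimage (measurable_const_mul _))

/-- The cells are half-open; adding the left endpoint `q^(1-i_k)`, which is still positive, makes
them compact. -/
theorem isCompactPos_iUnion_cells (hq0 : 0 < q) {m : ℕ} (F : Finset (Idx m)) :
    ∃ C : Set (X q m), IsCompactPos C ∧ ∀ i ∈ F, cellSet q i ⊆ C := by
  refine ⟨⋃ i ∈ F, {fun l => powIq q (i.1 l)} ×ˢ
    Set.Icc ((q ^ i.2)⁻¹ * q) ((q ^ i.2)⁻¹), ⟨?_, ?_⟩, ?_⟩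
  · exact F.isCompact_biUnion fun i _ => isCompact_singleton.prod isCompact_Icc
  · intro t ht
    obtain ⟨i, _, ht⟩ := Set.mem_iUnion₂.mp ht
    exact (mul_pos (inv_pos.mpr (zpow_pos hq0 _)) hq0).trans_le ht.2.1
  · intro i hi t ht
    refine Set.mem_iUnion₂.mpr ⟨i, hi, ht.1, ?_, ?_⟩
    · rw [inv_mul_le_iff₀ (zpow_pos hq0 _)]
      exact ht.2.1.le
    · rw [le_inv_comm₀ (pos_of_mul_pos_right (hq0.trans ht.2.1) zero_le) (zpow_pos hq0 _),
        ← one_div, le_div_iff₀ (pos_of_mul_pos_right (hq0.trans ht.2.1) zero_le)]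
      exact ht.2.2

/-- On `C` the functions `t_l`, `t_k` and `t_k⁻¹` are continuous, hence bounded, and this bounds the
entries of the index of a cell meeting `C`. -/
theorem finite_cells_of_isCompactPos (hq0 : 0 < q) (hq1 : q < 1) {m : ℕ} {C : Set (X q m)}
    (hC : IsCompactPos C) : {i : Idx m | (cellSet q i ∩ C).Nonempty}.Finite := by
  obtain ⟨b, hb⟩ := hC.1.bddAbove_image (f := fun t => t.2) (by fun_prop)
  obtain ⟨a, ha⟩ := hC.1.bddAbove_image (f := fun t => t.2⁻¹)
    (ContinuousOn.inv₀ (f := fun t : X q m => t.2) (by fun_prop) fun t ht => (hC.2 t ht).ne')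
  have hR : ∀ l, ∃ R, ∀ t ∈ C, (t.1 l : ℝ≥0) ≤ R := fun l => by
    obtain ⟨R, hR⟩ := hC.1.bddAbove_image (f := fun t => (t.1 l : ℝ≥0)) (by fun_prop)
    exact ⟨R, fun t ht => hR ⟨t, ht, rfl⟩⟩
  choose R hR using hR
  have hex : ∀ r : ℝ≥0, ∃ M : ℕ, r * q ^ M < 1 := fun r => by
    obtain ⟨M, hM⟩ := exists_pow_lt_of_lt_one (show 0 < (r + 1)⁻¹ by positivity) hq1
    refine ⟨M, ?_⟩
    rw [← one_div, lt_div_iff₀ (by positivity)] at hM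
    calc r * q ^ M ≤ q ^ M * (r + 1) := by rw [mul_comm]; gcongr; exact le_self_add
      _ < 1 := hM
  choose M hM using hex
  have h1 : (Set.univ.pi fun l : Fin m => {p : ℕ+ | (p : ℕ) < M (R l)}).Finite :=
    Set.Finite.pi fun l => (Set.finite_lt_nat (M (R l))).preimage PNat.coe_injective.injOn
  -- The bound `t_l ≤ R l` gives `i_l < M (R l)`; `t_k⁻¹ ≤ a` gives `i_k > -M a`, as `q^(i_k) t_k ≤
  -- 1`; `t_k ≤ b` gives `i_k < M (b * q⁻¹)`, as `q < q^(i_k) t_k`.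
  refine (h1.prod (Set.finite_Ioo (-(M a : ℤ)) (M (b * q⁻¹)))).subset ?_
  rintro i ⟨t, ht, htC⟩
  have hb' : t.2 ≤ b := hb ⟨t, htC, rfl⟩
  have ha' : t.2⁻¹ ≤ a := ha ⟨t, htC, rfl⟩
  have ht2 := hC.2 t htC
  refine ⟨fun l _ => ?_, ?_, ?_⟩
  · by_contra! hc
    rw [Set.mem_ofPred_eq, not_lt] at hc
    have h2 := hR l t htC
    rw [ht.1] at h2
    have h3 : 1 ≤ R l * q ^ (i.1 l : ℕ) := by
      rw [← inv_mul_cancel₀ (pow_pos hq0 (i.1 l : ℕ)).ne']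
      gcongr
      exact h2
    refine (h3.trans ?_).not_gt (hM (R l))
    exact mul_le_mul_right (pow_le_pow_of_le_one zero_le hq1.le hc) _
  · by_contra! hc
    have h2 : q ^ (-(M a : ℤ)) * t.2 ≤ 1 := by
      refine le_trans ?_ ht.2.2
      exact mul_le_mul_left (zpow_le_zpow_right_of_le_one₀ hq0 hq1.le hc) _
    have h3 : 1 ≤ a * q ^ M a := by
      calc 1 ≤ t.2⁻¹ * q ^ M a := ?_
        _ ≤ _ := by gcongr
      rw [zpow_neg, zpow_natCast, inv_mul_le_iff₀ (pow_pos hq0 _), mul_one] at h2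
      rwa [inv_mul_eq_div, one_le_div ht2]
    exact h3.not_gt (hM a)
  · by_contra! hc
    have h2 : q < q ^ (M (b * q⁻¹)) * b := by
      refine ht.2.1.trans_le ?_
      rw [← zpow_natCast]
      refine mul_le_mul' (zpow_le_zpow_right_of_le_one₀ hq0 hq1.le hc) hb'
    have h3 := hM (b * q⁻¹)
    rw [mul_right_comm, mul_comm b, ← div_eq_mul_inv, div_lt_one hq0] at h3
    exact (h2.trans h3).false

end Cells

/-! ### The space `L²(μ_k)` as a Hilbert sum of copies of `L²((q, 1], ν)` -/

section CellMaps

variable {q : ℝ≥0}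

theorem measurePreserving_inv_mul (hq0 : 0 < q) (N : QInvMeasure q) :
    MeasurePreserving (fun t => q⁻¹ * t) N.ν N.ν := by
  have hm : Measurable (fun t : ℝ≥0 => q⁻¹ * t) := measurable_const_mul _
  refine ⟨hm, Measure.ext fun s hs => ?_⟩
  rw [Measure.map_apply hm hs, ← N.invariant s hs]
  congr 1
  ext t
  simp only [Set.mem_preimage, Set.mem_image]
  constructor
  · intro h
    exact ⟨_, h, mul_inv_cancel_left₀ hq0.ne' t⟩
  · rintro ⟨s, hs, rfl⟩
    rwa [inv_mul_cancel_left₀ hq0.ne']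

theorem measurePreserving_mul (hq0 : 0 < q) (N : QInvMeasure q) :
    MeasurePreserving (fun t => q * t) N.ν N.ν := by
  have h := (measurePreserving_inv_mul hq0 N).symm
    (MeasurableEquiv.mulLeft₀ q⁻¹ (inv_ne_zero hq0.ne'))
  convert h using 1
  funext t
  simp [MeasurableEquiv.mulLeft₀]

theorem measurePreserving_zpow_mul (hq0 : 0 < q) (N : QInvMeasure q) (k : ℤ) :
    MeasurePreserving (fun t => q ^ k * t) N.ν N.ν := by
  induction k using Int.induction_on with
  | zero => simpa using! MeasurePreserving.id N.ν
  | succ k ih =>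
    convert ih.comp (measurePreserving_mul hq0 N) using 1
    funext t
    simp [zpow_add₀ hq0.ne', mul_assoc]
  | pred k ih =>
    convert ih.comp (measurePreserving_inv_mul hq0 N) using 1
    funext t
    simp [zpow_sub₀ hq0.ne', mul_assoc, div_eq_mul_inv]

/-- `t ↦ q^{i_k} t_k`, which maps the cell with index `i` onto `(q, 1]`. -/
def cellProj (q : ℝ≥0) {m : ℕ} (i : Idx m) (t : X q m) : ℝ≥0 := q ^ i.2 * t.2

/-- The inverse of `cellProj` on the cell with index `i`. -/
def cellSec (q : ℝ≥0) {m : ℕ} (i : Idx m) (x : ℝ≥0) : X q m :=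
  (fun l => powIq q (i.1 l), q ^ (-i.2) * x)

theorem cellProj_cellSec (hq0 : 0 < q) {m : ℕ} (i : Idx m) (x : ℝ≥0) :
    cellProj q i (cellSec q i x) = x := by
  rw [cellProj, cellSec, ← mul_assoc, ← zpow_add₀ hq0.ne', add_neg_cancel, zpow_zero, one_mul]

theorem cellSec_cellProj (hq0 : 0 < q) {m : ℕ} {i : Idx m} {t : X q m} (h : t ∈ cellSet q i) :
    cellSec q i (cellProj q i t) = t := by
  refine Prod.ext h.1.symm ?_
  rw [cellProj, cellSec, ← mul_assoc, ← zpow_add₀ hq0.ne', neg_add_cancel, zpow_zero, one_mul]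

/-- The discrete coordinates contribute a single atom of mass one, and multiplication by a power of
`q` preserves `ν`. -/
theorem measurePreserving_cellSec (hq0 : 0 < q) {m : ℕ} (N : QInvMeasure q) (i : Idx m) :
    MeasurePreserving (cellSec q i) (N.ν.restrict (Set.Ioc q 1))
      ((mu m N).restrict (cellSet q i)) := by
  have h1 := (measurePreserving_zpow_mul hq0 N (-i.2)).restrict_preimage
    (s := (fun s => q ^ i.2 * s) ⁻¹' Set.Ioc q 1)
    (measurableSet_Ioc.preimage (measurable_const_mul _))
  have h2 : (fun t => q ^ (-i.2) * t) ⁻¹' ((fun s => q ^ i.2 * s) ⁻¹' Set.Ioc q 1) =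
      Set.Ioc q 1 := by
    ext x
    have := cellProj_cellSec hq0 i x
    simp only [cellProj, cellSec] at this
    rw [Set.mem_preimage, Set.mem_preimage, this]
  rw [h2] at h1
  have h3 : MeasurePreserving (Prod.mk (fun l => powIq q (i.1 l)))
      (N.ν.restrict ((fun s => q ^ i.2 * s) ⁻¹' Set.Ioc q 1))
      ((mu m N).restrict (cellSet q i)) := by
    refine ⟨measurable_prodMk_left, ?_⟩
    rw [mu, cellSet, ← Measure.prod_restrict, Measure.restrict_singleton, ← Measure.dirac_prod]
    congr 1
    rw [← Set.univ_pi_singleton, Measure.pi_pi]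
    simp
  exact h3.comp h1

theorem measurePreserving_cellProj (hq0 : 0 < q) {m : ℕ} (N : QInvMeasure q) (i : Idx m) :
    MeasurePreserving (cellProj q i) ((mu m N).restrict (cellSet q i))
      (N.ν.restrict (Set.Ioc q 1)) := by
  have hm : Measurable (cellProj q i) := (measurable_const_mul _).comp measurable_snd
  have h := measurePreserving_cellSec hq0 N i
  refine ⟨hm, ?_⟩
  rw [← h.map_eq, Measure.map_map hm h.measurable]
  have : cellProj q i ∘ cellSec q i = id := funext fun x => cellProj_cellSec hq0 i x
  rw [this, Measure.map_id]

theorem memLp_cell (hq0 : 0 < q) {m : ℕ} {N : QInvMeasure q} (i : Idx m)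
    (g : Lp ℂ 2 (N.ν.restrict (Set.Ioc q 1))) :
    MemLp ((cellSet q i).indicator (g ∘ cellProj q i)) 2 (mu m N) :=
  (memLp_indicator_iff_restrict (measurableSet_cellSet i)).mpr
    ((Lp.memLp g).comp_measurePreserving (measurePreserving_cellProj hq0 N i))

/-- The isometry `g ↦ g ∘ cellProj i` from `L²((q, 1], ν)` to the functions living on the cell
with index `i`. -/
def cellMap (hq0 : 0 < q) {m : ℕ} (N : QInvMeasure q) (i : Idx m) :
    Lp ℂ 2 (N.ν.restrict (Set.Ioc q 1)) →ₗᵢ[ℂ] L2 m N where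
  toFun g := (memLp_cell hq0 i g).toLp
  map_add' f g := by
    rw [← MemLp.toLp_add, MemLp.toLp_eq_toLp_iff]
    have h := (ae_restrict_iff' (measurableSet_cellSet i)).mp
      ((measurePreserving_cellProj hq0 N i).quasiMeasurePreserving.ae (Lp.coeFn_add f g))
    filter_upwards [h] with t ht
    by_cases hc : t ∈ cellSet q i
    · simp only [Pi.add_apply, Set.indicator_of_mem hc, Function.comp_apply, ht hc]
    · simp only [Pi.add_apply, Set.indicator_of_notMem hc, add_zero]
  map_smul' c g := by
    rw [RingHom.id_apply, ← MemLp.toLp_const_smul, MemLp.toLp_eq_toLp_iff]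
    have h := (ae_restrict_iff' (measurableSet_cellSet i)).mp
      ((measurePreserving_cellProj hq0 N i).quasiMeasurePreserving.ae (Lp.coeFn_smul c g))
    filter_upwards [h] with t ht
    by_cases hc : t ∈ cellSet q i
    · simp only [Pi.smul_apply, Set.indicator_of_mem hc, Function.comp_apply, ht hc]
    · simp only [Pi.smul_apply, Set.indicator_of_notMem hc, smul_zero]
  norm_map' g := by
    change ‖(memLp_cell hq0 i g).toLp‖ = _
    rw [Lp.norm_toLp, eLpNorm_indicator_eq_eLpNorm_restrict (measurableSet_cellSet i),
      eLpNorm_comp_measurePreserving (Lp.aestronglyMeasurable g)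
        (measurePreserving_cellProj hq0 N i), Lp.norm_def]

theorem cellMap_coe (hq0 : 0 < q) {m : ℕ} {N : QInvMeasure q} (i : Idx m)
    (g : Lp ℂ 2 (N.ν.restrict (Set.Ioc q 1))) :
    cellMap hq0 N i g =ᵐ[mu m N] (cellSet q i).indicator (g ∘ cellProj q i) :=
  (memLp_cell hq0 i g).coeFn_toLp

/-- The restriction of a function to the cell with index `i`, as a function on `(q, 1]`. -/
def cellRestr (hq0 : 0 < q) {m : ℕ} {N : QInvMeasure q} (i : Idx m) (f : L2 m N) :
    Lp ℂ 2 (N.ν.restrict (Set.Ioc q 1)) :=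
  (((Lp.memLp f).restrict (cellSet q i)).comp_measurePreserving
    (measurePreserving_cellSec hq0 N i)).toLp

theorem cellMap_cellRestr (hq0 : 0 < q) {m : ℕ} {N : QInvMeasure q} (i : Idx m) (f : L2 m N) :
    cellMap hq0 N i (cellRestr hq0 i f) =ᵐ[mu m N] (cellSet q i).indicator f := by
  have h := (ae_restrict_iff' (measurableSet_cellSet i)).mp
    ((measurePreserving_cellProj hq0 N i).quasiMeasurePreserving.ae
      (((Lp.memLp f).restrict (cellSet q i)).comp_measurePreserving
        (measurePreserving_cellSec hq0 N i)).coeFn_toLp)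
  filter_upwards [cellMap_coe hq0 i (cellRestr hq0 i f), h] with t h1 h2
  rw [h1]
  by_cases hc : t ∈ cellSet q i
  · rw [Set.indicator_of_mem hc, Set.indicator_of_mem hc, Function.comp_apply]
    refine (h2 hc).trans ?_
    rw [Function.comp_apply, cellSec_cellProj hq0 hc]
  · rw [Set.indicator_of_notMem hc, Set.indicator_of_notMem hc]

theorem orthogonalFamily_cellMap (hq0 : 0 < q) (hq1 : q < 1) (m : ℕ) (N : QInvMeasure q) :
    OrthogonalFamily ℂ (fun _ : Idx m => Lp ℂ 2 (N.ν.restrict (Set.Ioc q 1)))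
      (cellMap hq0 N) := by
  intro i i' hi f g
  rw [L2.inner_def]
  refine integral_eq_zero_of_ae ?_
  filter_upwards [cellMap_coe hq0 i f, cellMap_coe hq0 i' g] with t h1 h2
  rw [h1, h2]
  by_cases hc : t ∈ cellSet q i
  · have : t ∉ cellSet q i' := fun hc' => hi (cellSet_inj hq0 hq1 hc hc')
    rw [Set.indicator_of_notMem this, inner_zero_right, Pi.zero_apply]
  · rw [Set.indicator_of_notMem hc, inner_zero_left, Pi.zero_apply]

/-- A function is orthogonal to all functions living on a cell iff it vanishes there. -/
theorem forall_inner_cellMap_eq_zero (hq0 : 0 < q) {m : ℕ} {N : QInvMeasure q} (i : Idx m)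
    (f : L2 m N) :
    (∀ g, inner ℂ (cellMap hq0 N i g) f = 0) ↔ ∀ᵐ t ∂(mu m N), t ∈ cellSet q i → f t = 0 := by
  constructor
  · intro h
    have h1 : inner ℂ (cellMap hq0 N i (cellRestr hq0 i f))
        (cellMap hq0 N i (cellRestr hq0 i f)) = 0 := by
      rw [← h (cellRestr hq0 i f), L2.inner_def, L2.inner_def]
      refine integral_congr_ae ?_
      filter_upwards [cellMap_cellRestr hq0 i f] with t ht
      rw [ht]
      by_cases hc : t ∈ cellSet q i
      · rw [Set.indicator_of_mem hc]
      · rw [Set.indicator_of_notMem hc, inner_zero_left, inner_zero_left]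
    rw [inner_self_eq_zero] at h1
    have h2 := cellMap_cellRestr hq0 i f
    rw [h1] at h2
    filter_upwards [h2, Lp.coeFn_zero ℂ 2 (mu m N)] with t h3 h4 hc
    rw [h4, Set.indicator_of_mem hc] at h3
    exact h3.symm
  · intro h g
    rw [L2.inner_def]
    refine integral_eq_zero_of_ae ?_
    filter_upwards [cellMap_coe hq0 i g, h] with t h1 h2
    rw [h1]
    by_cases hc : t ∈ cellSet q i
    · rw [h2 hc, inner_zero_right, Pi.zero_apply]
    · rw [Set.indicator_of_notMem hc, inner_zero_left, Pi.zero_apply]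

theorem ae_snd_ne_zero {m : ℕ} (N : QInvMeasure q) : ∀ᵐ t ∂(mu m N), t.2 ≠ 0 := by
  have h : ∀ᵐ s ∂N.ν, s ≠ 0 := by
    rw [ae_iff]
    simpa using N.zero_null
  exact Measure.quasiMeasurePreserving_snd.ae h

/-- There are countably many cells, so the exceptional null sets may be united; the cells cover
everything except `t_k = 0`, which is a null set because `ν {0} = 0`. -/
theorem eq_zero_of_vanishes_on_cells (hq0 : 0 < q) (hq1 : q < 1) {m : ℕ} {N : QInvMeasure q}
    {f : L2 m N} (h : ∀ i : Idx m, ∀ᵐ t ∂(mu m N), t ∈ cellSet q i → f t = 0) : f = 0 := by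
  rw [Lp.eq_zero_iff_ae_eq_zero]
  filter_upwards [ae_all_iff.mpr h, ae_snd_ne_zero N] with t h1 h2
  obtain ⟨i, hi⟩ := exists_mem_cellSet hq0 hq1 t h2
  exact h1 i hi

/-- The vanishing of a function outside of a compact set, in terms of cells. -/
theorem vanishesOff_of_cells (hq0 : 0 < q) (hq1 : q < 1) {m : ℕ} {N : QInvMeasure q}
    {f : L2 m N} {F : Set (Idx m)} {C : Set (X q m)} (hFC : ∀ i ∈ F, cellSet q i ⊆ C)
    (h : ∀ i ∉ F, ∀ᵐ t ∂(mu m N), t ∈ cellSet q i → f t = 0) : VanishesOff f C := by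
  have h' : ∀ i : Idx m, ∀ᵐ t ∂(mu m N), i ∉ F → t ∈ cellSet q i → f t = 0 := fun i => by
    by_cases hi : i ∈ F
    · exact Eventually.of_forall fun t hc => absurd hi hc
    · filter_upwards [h i hi] with t ht _ using ht
  filter_upwards [ae_all_iff.mpr h', ae_snd_ne_zero N] with t h1 h2 h3
  obtain ⟨i, hi⟩ := exists_mem_cellSet hq0 hq1 t h2
  exact h1 i (fun hF => h3 (hFC i hF hi)) hi

theorem VanishesOff.ae_cell {m : ℕ} {N : QInvMeasure q} {f : L2 m N} {C : Set (X q m)}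
    (h : VanishesOff f C) {i : Idx m} (hi : ¬ (cellSet q i ∩ C).Nonempty) :
    ∀ᵐ t ∂(mu m N), t ∈ cellSet q i → f t = 0 := by
  filter_upwards [h] with t ht hc
  exact ht fun hC => hi ⟨t, hc, hC⟩

theorem cellMap_mem_compDomain (hq0 : 0 < q) {m : ℕ} {N : QInvMeasure q} (i : Idx m)
    (g : Lp ℂ 2 (N.ν.restrict (Set.Ioc q 1))) : cellMap hq0 N i g ∈ compDomain m N := by
  obtain ⟨C, hC, hC'⟩ := isCompactPos_iUnion_cells hq0 {i}
  refine ⟨C, hC, ?_⟩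
  filter_upwards [cellMap_coe hq0 i g] with t ht hc
  rw [ht, Set.indicator_of_notMem fun h => hc (hC' i (by simp) h)]

/-- A function with compact support meets finitely many cells and is the sum of its restrictions to
them. -/
theorem compDomain_eq_range (hq0 : 0 < q) (hq1 : q < 1) (m : ℕ) (N : QInvMeasure q) :
    compDomain m N = LinearMap.range (sumMap (cellMap (m := m) hq0 N)) := by
  refine le_antisymm ?_ ?_
  · rintro f ⟨C, hC, hf⟩
    set F := (finite_cells_of_isCompactPos hq0 hq1 hC).toFinset with hF
    refine ⟨∑ i ∈ F, Finsupp.single i (cellRestr hq0 i f), ?_⟩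
    rw [map_sum, ← sub_eq_zero]
    -- The difference is tested against the functions living on one cell, to which only the summand
    -- of the same cell contributes; off `F` the function itself vanishes on the cell.
    refine eq_zero_of_vanishes_on_cells hq0 hq1 fun i => ?_
    rw [← forall_inner_cellMap_eq_zero hq0]
    intro g
    simp only [sumMap_single, inner_sub_right, inner_sum]
    by_cases hi : i ∈ F
    · rw [Finset.sum_eq_single_of_mem i hi fun i' _ hi' =>
        orthogonalFamily_cellMap hq0 hq1 m N hi'.symm _ _, sub_eq_zero, L2.inner_def,
        L2.inner_def]
      refine integral_congr_ae ?_
      filter_upwards [cellMap_coe hq0 i g, cellMap_cellRestr hq0 i f] with t h1 h2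
      rw [h1, h2]
      by_cases hc : t ∈ cellSet q i
      · rw [Set.indicator_of_mem hc, Set.indicator_of_mem hc]
      · rw [Set.indicator_of_notMem hc, inner_zero_left, inner_zero_left]
    · rw [Finset.sum_eq_zero fun i' hi' => orthogonalFamily_cellMap hq0 hq1 m N
        (fun h : i = i' => hi (h ▸ hi')) _ _, zero_sub, neg_eq_zero]
      have := hf.ae_cell (i := i) (by simpa [hF] using hi)
      exact (forall_inner_cellMap_eq_zero hq0 i f).mpr this g
  · rintro _ ⟨p, rfl⟩
    induction p using Finsupp.induction_linear with
    | zero => simp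
    | add x y hx hy => rw [map_add]; exact Submodule.add_mem _ hx hy
    | single i g => rw [sumMap_single]; exact cellMap_mem_compDomain hq0 i g

theorem dense_compDomain (hq0 : 0 < q) (hq1 : q < 1) (m : ℕ) (N : QInvMeasure q) :
    Dense (compDomain m N : Set (L2 m N)) := by
  rw [Submodule.dense_iff_topologicalClosure_eq_top, Submodule.topologicalClosure_eq_top_iff,
    Submodule.eq_bot_iff]
  intro f hf
  refine eq_zero_of_vanishes_on_cells hq0 hq1 fun i => ?_
  rw [← forall_inner_cellMap_eq_zero hq0]
  exact fun g => hf _ (cellMap_mem_compDomain hq0 i g)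

end CellMaps

/-! ### The concrete operators as weighted shifts between cells -/

section ConcreteOperators

variable {q : ℝ≥0}

theorem mul_powIq_add_one (hq0 : 0 < q) (a : ℕ+) :
    q * (powIq q (a + 1) : ℝ≥0) = (powIq q a : ℝ≥0) := by
  simp only [powIq, PNat.add_coe, PNat.one_coe, pow_succ, mul_inv]
  rw [mul_comm, mul_assoc, inv_mul_cancel₀ hq0.ne', mul_one]

theorem scaleIq_powIq_add_one (hq0 : 0 < q) (a : ℕ+) : scaleIq q (powIq q (a + 1)) = powIq q a := by
  have h := mul_powIq_add_one hq0 a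
  have h' : q * (powIq q (a + 1) : ℝ≥0) ∈ Iq q := h ▸ (powIq q a).2
  rw [scaleIq, dif_pos h']
  exact Subtype.ext h

/-- Where the coefficient does not vanish, `scale` maps exactly the cell with index
`raiseIdx m j i` to the cell with index `i`. -/
theorem scale_mem_cellSet (hq0 : 0 < q) (hq1 : q < 1) {m j : ℕ} {i : Idx m} {t : X q m}
    (ht : coef q m j t ≠ 0) : scale q m j t ∈ cellSet q i ↔ t ∈ cellSet q (raiseIdx m j i) := by
  by_cases hj : j < m
  · choose a ha using fun l => powIq_surjective (t.1 l)
    have hat : t.1 = fun l => powIq q (a l) := funext fun l => (ha l).symm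
    -- At `t_j = q⁻¹` the root in the coefficient is zero. Elsewhere `q t_j` stays in `I_q` and
    -- `scaleIq` does not take its default value.
    have ha1 : a ⟨j, hj⟩ ≠ 1 := by
      intro h1
      refine ht ?_
      have : (q : ℝ) ≠ 0 := by exact_mod_cast hq0.ne'
      simp [coef, hj, hat, h1, powIq, this]
    obtain ⟨b, hb⟩ := PNat.exists_eq_succ_of_ne_one ha1
    have hinj := powIq_injective hq0 hq1
    simp only [mem_cellSet, scale, raiseIdx, hj, dif_pos, hat, hb, scaleIq_powIq_add_one hq0]
    refine and_congr_left fun _ => ?_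
    constructor
    · intro h
      funext l
      have hl := congrFun h l
      by_cases hlj : l = ⟨j, hj⟩
      · subst hlj
        simp only [Function.update_self] at hl ⊢
        rw [hb, hinj hl]
      · simp only [Function.update_of_ne hlj] at hl ⊢
        exact hl
    · intro h
      funext l
      have hl := congrFun h l
      by_cases hlj : l = ⟨j, hj⟩
      · subst hlj
        simp only [Function.update_self] at hl ⊢
        rw [hb] at hl
        rw [add_right_cancel (hinj hl)]
      · simp only [Function.update_of_ne hlj] at hl ⊢
        exact hl
  · by_cases hjm : j = m
    · subst hjm
      simp only [mem_cellSet, scale, raiseIdx, lt_irrefl, dif_neg, not_false_iff, if_true,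
        zpow_add₀ hq0.ne', zpow_one, mul_assoc]
    · simp [coef, hj, hjm] at ht

theorem cellProj_scale (hq0 : 0 < q) {m j : ℕ} (i : Idx m) (t : X q m) :
    cellProj q i (scale q m j t) = cellProj q (raiseIdx m j i) t := by
  by_cases hj : j < m
  · simp [cellProj, scale, raiseIdx, hj]
  · by_cases hjm : j = m
    · simp [cellProj, scale, raiseIdx, hjm, zpow_add₀ hq0.ne', mul_assoc]
    · simp [cellProj, scale, raiseIdx, hj, hjm]

/-- On the raised cell `q t_j = q^(-i_j)` for `j < k`, and `t_k` is a power of `q` times the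
coordinate `x ∈ (q, 1]`. As `t_k` occurs to the first power, a weight depending only on the index
splits off and `x` remains; it is the operator `A` of the shift. -/
theorem coef_of_mem_cellSet (hq0 : 0 < q) {m j : ℕ} {i : Idx m} {t : X q m}
    (ht : t ∈ cellSet q (raiseIdx m j i)) :
    coef q m j t = stdCoef (q : ℝ) m j i * (cellProj q (raiseIdx m j i) t : ℝ) := by
  have hq : (q : ℝ) ≠ 0 := by exact_mod_cast hq0.ne'
  by_cases hj : j < m
  · have h1 : (q : ℝ) * ((t.1 ⟨j, hj⟩ : ℝ≥0) : ℝ) = (q : ℝ) ^ (-((i.1 ⟨j, hj⟩ : ℕ) : ℤ)) := by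
      rw [ht.1]
      simp only [raiseIdx, hj, dif_pos, Function.update_self, ← NNReal.coe_mul,
        mul_powIq_add_one hq0]
      simp [powIq]
    have h2 : ∏ l ∈ Finset.univ.filter (fun l : Fin m => j < l), ((t.1 l : ℝ≥0) : ℝ) =
        (q : ℝ) ^ (-∑ l ∈ Finset.univ.filter (fun l : Fin m => j < l), ((i.1 l : ℕ) : ℤ)) := by
      rw [zpow_neg, ← Nat.cast_sum, zpow_natCast, ← Finset.prod_pow_eq_pow_sum,
        ← Finset.prod_inv_distrib]
      refine Finset.prod_congr rfl fun l hl => ?_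
      have hlj : l ≠ ⟨j, hj⟩ := by
        rintro rfl
        simp at hl
      rw [ht.1]
      simp [powIq, raiseIdx, hj, Function.update_of_ne hlj]
    have h3 : (t.2 : ℝ) = (q : ℝ) ^ (-i.2) * (cellProj q (raiseIdx m j i) t : ℝ) := by
      simp only [cellProj, raiseIdx, hj, dif_pos, NNReal.coe_mul, NNReal.coe_zpow]
      rw [← mul_assoc, ← zpow_add₀ hq, neg_add_cancel, zpow_zero, one_mul]
    simp only [coef, stdCoef, hj, dif_pos, h1, h2]
    rw [h3, ← zpow_natCast, ← zpow_mul, neg_add, zpow_add₀ hq]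
    have : -((i.1 ⟨j, hj⟩ : ℕ) : ℤ) * ((2 : ℕ) : ℤ) = -2 * ((i.1 ⟨j, hj⟩ : ℕ) : ℤ) := by
      push_cast; ring
    rw [this]
    ring
  · by_cases hjm : j = m
    · subst hjm
      simp only [coef, stdCoef, cellProj, raiseIdx, lt_irrefl, dif_neg, not_false_iff, if_true,
        NNReal.coe_mul, NNReal.coe_zpow]
      rw [zpow_add₀ hq, zpow_one, ← mul_assoc, ← mul_assoc, ← zpow_add₀ hq, neg_add_cancel,
        zpow_zero, one_mul]
    · simp [coef, stdCoef, hj, hjm]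

theorem opFun_cellMap (hq0 : 0 < q) (hq1 : q < 1) {m : ℕ} {N : QInvMeasure q} (j : ℕ)
    (i : Idx m) (g : Lp ℂ 2 (N.ν.restrict (Set.Ioc q 1))) :
    opFun m j N (cellMap hq0 N i g) =ᵐ[mu m N]
      cellMap hq0 N (raiseIdx m j i) ((stdCoef (q : ℝ) m j i : ℂ) • mulOp _ g) := by
  set A := (stdCoef (q : ℝ) m j i : ℂ) • mulOp _ g with hA
  have hAg : A =ᵐ[N.ν.restrict (Set.Ioc q 1)]
      fun x => (stdCoef (q : ℝ) m j i : ℂ) * (((min x 1 : ℝ≥0) : ℂ) * g x) := by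
    filter_upwards [Lp.coeFn_smul (stdCoef (q : ℝ) m j i : ℂ) (mulOp _ g), mulOp_coe g]
      with x h1 h2
    rw [hA, h1, Pi.smul_apply, h2, smul_eq_mul]
  have h1 := (ae_restrict_iff' (measurableSet_cellSet _)).mp
    ((measurePreserving_cellProj (m := m) hq0 N
      (raiseIdx m j i)).quasiMeasurePreserving.ae hAg)
  filter_upwards [(quasi_scale m j N).ae (cellMap_coe hq0 i g),
    cellMap_coe hq0 (raiseIdx m j i) A, h1] with t h2 h3 h4
  rw [opFun, h2, h3]
  by_cases hc : t ∈ cellSet q (raiseIdx m j i)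
  · rw [Set.indicator_of_mem hc, Function.comp_apply, h4 hc,
      min_eq_left (show cellProj q (raiseIdx m j i) t ≤ 1 from hc.2.2)]
    have hcoef := coef_of_mem_cellSet hq0 hc
    -- Where the coefficient vanishes nothing is known about the cell of `scale q m j t`, but both
    -- sides are zero.
    by_cases h0 : coef q m j t = 0
    · rw [h0, Complex.ofReal_zero, zero_mul, ← mul_assoc]
      rw [h0] at hcoef
      have : ((stdCoef (q : ℝ) m j i : ℝ) : ℂ) *
          (((cellProj q (raiseIdx m j i) t : ℝ≥0) : ℝ) : ℂ) = 0 := by exact_mod_cast hcoef.symm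
      exact (mul_eq_zero_of_left this _).symm
    · rw [Set.indicator_of_mem ((scale_mem_cellSet hq0 hq1 h0).mpr hc), Function.comp_apply,
        cellProj_scale hq0, hcoef, Complex.ofReal_mul, mul_assoc]
  · rw [Set.indicator_of_notMem hc]
    by_cases h0 : coef q m j t = 0
    · rw [h0, Complex.ofReal_zero, zero_mul]
    · rw [Set.indicator_of_notMem fun h => hc ((scale_mem_cellSet hq0 hq1 h0).mp h), mul_zero]

theorem concreteOp_cellMap (hq0 : 0 < q) (hq1 : q < 1) {m : ℕ} {N : QInvMeasure q} (j : ℕ)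
    (i : Idx m) (g : Lp ℂ 2 (N.ν.restrict (Set.Ioc q 1))) :
    (cellMap hq0 N i g, cellMap hq0 N (raiseIdx m j i)
      ((stdCoef (q : ℝ) m j i : ℂ) • mulOp _ g)) ∈ (concreteOp m N j).graph := by
  have h := opFun_cellMap hq0 hq1 j i g
  have hm : MemLp (opFun m j N (cellMap hq0 N i g)) 2 (mu m N) :=
    (memLp_congr_ae h).mpr (Lp.memLp _)
  rw [LinearPMap.mem_graph_iff]
  refine ⟨⟨cellMap hq0 N i g, cellMap_mem_compDomain hq0 i g, hm⟩, rfl, ?_⟩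
  change hm.toLp _ = _
  exact Lp.ext (hm.coeFn_toLp.trans h)

theorem concreteOp_sumMap (hq0 : 0 < q) (hq1 : q < 1) {m : ℕ} {N : QInvMeasure q} (j : ℕ)
    (p : Idx m →₀ Lp ℂ 2 (N.ν.restrict (Set.Ioc q 1))) :
    (sumMap (cellMap hq0 N) p, sumMap (cellMap hq0 N)
      (raiseShift (q : ℝ) m (mulOp _).toLinearMap j p)) ∈ (concreteOp m N j).graph := by
  induction p using Finsupp.induction_linear with
  | zero => simp only [map_zero]; exact (concreteOp m N j).graph.zero_mem
  | add x y hx hy => simpa only [map_add] using! (concreteOp m N j).graph.add_mem hx hy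
  | single i g =>
    rw [raiseShift_single, sumMap_single, sumMap_single]
    exact concreteOp_cellMap hq0 hq1 j i g

/-- The square-integrability required in the domain of `concreteOp` holds automatically on `D_k`:
each cell function is mapped to a cell function with a constant weight and a bounded multiplication,
and elements of `D_k` are finite sums of these. -/
theorem concreteOp_domain (hq0 : 0 < q) (hq1 : q < 1) (m : ℕ) (N : QInvMeasure q) (j : ℕ) :
    (concreteOp m N j).domain = compDomain m N := by
  refine le_antisymm (fun f hf => hf.1) ?_
  rw [compDomain_eq_range hq0 hq1]
  rintro _ ⟨p, rfl⟩
  exact LinearPMap.mem_domain_of_mem_graph (concreteOp_sumMap hq0 hq1 j p)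

theorem isStarRep_concreteOp (hq0 : 0 < q) (hq1 : q < 1) {n m : ℕ} (hm : m < n)
    (N : QInvMeasure q) :
    (∀ j : Fin n, (concreteOp m N j).IsClosable) ∧
      IsStarRep (q : ℝ) (compDomain m N) (fun j : Fin n => (concreteOp m N j).closure) :=
  isStarRep_of_shift (A := (mulOp (N.ν.restrict (Set.Ioc q 1))).toLinearMap) (by exact_mod_cast hq0)
    (by exact_mod_cast hq1) hm
    (orthogonalFamily_cellMap hq0 hq1 m N) inner_mulOp (compDomain_eq_range hq0 hq1 m N)
    (dense_compDomain hq0 hq1 m N) (fun j : Fin n => concreteOp m N j)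
    (fun j => concreteOp_domain hq0 hq1 m N j) (fun j p => concreteOp_sumMap hq0 hq1 j p)

end ConcreteOperators

/-! ### Cyclic subspaces of a self-adjoint operator -/

section Spectral

open scoped BoundedContinuousFunction CompactlySupported

variable {K : Type u} [NormedAddCommGroup K] [InnerProductSpace ℂ K] [CompleteSpace K]

theorem inner_starAlgHom_star_mul {R : Type v} [Semiring R] [Algebra ℂ R] [Star R]
    (π : R →⋆ₐ[ℂ] (K →L[ℂ] K)) (F G : R) (v w : K) :
    inner ℂ (π (star F * G) v) w = inner ℂ (π G v) (π F w) := by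
  rw [map_mul, map_star, ContinuousLinearMap.star_eq_adjoint, mul_apply_eq_comp,
    ContinuousLinearMap.adjoint_inner_left]

/-- The vector functional `F ↦ ⟪F v, v⟫` of a representation of `C(X)` is given by a measure. -/
theorem exists_vector_measure {X : Type v} [TopologicalSpace X] [CompactSpace X] [T2Space X]
    [MeasurableSpace X] [BorelSpace X] (π : C(X, ℂ) →⋆ₐ[ℂ] (K →L[ℂ] K)) (v : K) :
    ∃ μ : Measure X, IsFiniteMeasure μ ∧ ∀ F : C(X, ℂ), ‖π F v‖ ^ 2 = ∫ x, ‖F x‖ ^ 2 ∂μ := by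
  let c : C(X, ℝ) → C(X, ℂ) := fun f =>
    (⟨Complex.ofReal, Complex.continuous_ofReal⟩ : C(ℝ, ℂ)).comp f
  have hsq : ∀ (f : C(X, ℝ)) (F : C(X, ℂ)), (∀ x, f x = ‖F x‖ ^ 2) →
      (inner ℂ (π (c f) v) v).re = ‖π F v‖ ^ 2 := by
    intro f F h
    have : c f = star F * F := by
      ext x
      simp only [c, ContinuousMap.comp_apply, ContinuousMap.coe_mk, h x, ContinuousMap.mul_apply,
        ContinuousMap.star_apply]
      rw [Complex.star_def, ← Complex.normSq_eq_conj_mul_self, Complex.normSq_eq_norm_sq]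
    rw [this, inner_starAlgHom_star_mul, inner_self_eq_norm_sq_to_K]
    norm_cast
  let L : C_c(X, ℝ) →ₗ[ℝ] ℝ :=
    { toFun := fun f => (inner ℂ (π (c f) v) v).re
      map_add' := fun f g => by
        have : c (f + g : C_c(X, ℝ)) = c f + c g := by ext x; simp [c]
        rw [this, map_add, add_apply, inner_add_left, Complex.add_re]
      map_smul' := fun r f => by
        have : c (r • f : C_c(X, ℝ)) = (r : ℂ) • c f := by ext x; simp [c]
        rw [this, map_smul, smul_apply, inner_smul_left, Complex.conj_ofReal,
          Complex.re_ofReal_mul, RingHom.id_apply, smul_eq_mul] }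
  -- Positivity: a function `f ≥ 0` is the square of `√f`, so its value is `‖π (√f) v‖ ^ 2`.
  let Λ : C_c(X, ℝ) →ₚ[ℝ] ℝ := PositiveLinearMap.mk₀ L fun f hf => by
    let F : C(X, ℂ) := c ⟨fun x => √(f x), by fun_prop⟩
    have : L f = ‖π F v‖ ^ 2 := hsq f F fun x => by
      have h0 : 0 ≤ f x := hf x
      simp [F, c, Real.sq_sqrt h0]
    rw [this]
    positivity
  refine ⟨RealRMK.rieszMeasure Λ, ?_, fun F => ?_⟩
  · refine ⟨?_⟩
    refine (RealRMK.rieszMeasure_le_of_eq_one Λ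
      (f := CompactlySupportedContinuousMap.continuousMapEquiv (1 : C(X, ℝ))) (fun x => ?_)
      isCompact_univ fun x _ => ?_).trans_lt ENNReal.ofReal_lt_top
    · simp
    · simp
  · let f : C(X, ℝ) := ⟨fun x => ‖F x‖ ^ 2, by fun_prop⟩
    have h1 : L (CompactlySupportedContinuousMap.continuousMapEquiv f) = ‖π F v‖ ^ 2 :=
      hsq f F fun x => rfl
    have h2 := RealRMK.integral_rieszMeasure Λ
      (CompactlySupportedContinuousMap.continuousMapEquiv f)
    exact h1.symm.trans h2.symm

/-- The functional calculus `f ↦ f(A)` for continuous functions on `[0, ∞)`. -/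
def nnCalc {A : K →L[ℂ] K} (hA : IsSelfAdjoint A) : C(ℝ≥0, ℂ) →⋆ₐ[ℂ] (K →L[ℂ] K) :=
  (cfcHom (R := ℂ) hA.isStarNormal).comp (ContinuousMap.compStarAlgHom' ℂ ℂ
    ⟨fun z : spectrum ℂ A => (z : ℂ).re.toNNReal, by fun_prop⟩)

/-- The continuous function `x ↦ min x 1`. -/
def minOne : ℝ≥0 →ᵇ ℂ :=
  BoundedContinuousFunction.ofNormedAddCommGroup (fun x => (((min x 1 : ℝ≥0) : ℝ) : ℂ))
    (by fun_prop) 1 fun x => by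
      rw [Complex.norm_real, Real.norm_of_nonneg (NNReal.coe_nonneg _)]
      exact_mod_cast min_le_right x 1

variable {A : K →L[ℂ] K} {q : ℝ≥0}

theorem nnCalc_minOne (hA : IsSelfAdjoint A)
    (hs : spectrum ℂ A ⊆ Complex.ofReal '' Set.Icc (q : ℝ) 1) :
    nnCalc hA minOne.toContinuousMap = A := by
  conv_rhs => rw [← cfcHom_id (R := ℂ) (a := A) hA.isStarNormal]
  rw [nnCalc, StarAlgHom.comp_apply]
  congr 1
  ext z
  obtain ⟨r, hr, hz⟩ := hs z.2
  have h0 : 0 ≤ r := q.2.trans hr.1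
  have h1 : min r.toNNReal 1 = r.toNNReal := min_eq_left (Real.toNNReal_le_one.mpr hr.2)
  simp only [ContinuousMap.compStarAlgHom'_apply, ContinuousMap.comp_apply, ContinuousMap.coe_mk,
    ContinuousMap.restrict_apply, ContinuousMap.id_apply, ← hz, Complex.ofReal_re]
  change (((min r.toNNReal 1 : ℝ≥0) : ℝ) : ℂ) = r
  rw [h1, Real.coe_toNNReal r h0]

/-- The vector measure on the spectrum is pushed forward along the real part, which identifies the
spectrum with a subset of `[q, 1]`. -/
theorem exists_spectral_measure (hA : IsSelfAdjoint A)
    (hs : spectrum ℂ A ⊆ Complex.ofReal '' Set.Icc (q : ℝ) 1) (v : K) :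
    ∃ σ : Measure ℝ≥0, IsFiniteMeasure σ ∧ σ (Set.Icc q 1)ᶜ = 0 ∧
      ∀ F : C(ℝ≥0, ℂ), ‖nnCalc hA F v‖ ^ 2 = ∫ x, ‖F x‖ ^ 2 ∂σ := by
  obtain ⟨μ, hμ, h⟩ := exists_vector_measure (cfcHom (R := ℂ) hA.isStarNormal) v
  let τ : C(spectrum ℂ A, ℝ≥0) := ⟨fun z => (z : ℂ).re.toNNReal, by fun_prop⟩
  have hτ : Measurable τ := τ.continuous.measurable
  refine ⟨μ.map τ, Measure.isFiniteMeasure_map μ τ, ?_, fun F => ?_⟩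
  · rw [Measure.map_apply hτ measurableSet_Icc.compl]
    have : τ ⁻¹' (Set.Icc q 1)ᶜ = ∅ := by
      ext z
      obtain ⟨r, hr, hz⟩ := hs z.2
      have h2 : τ z = r.toNNReal := by simp [τ, ← hz]
      simp only [Set.mem_preimage, h2, Set.mem_compl_iff, Set.mem_Icc, Set.mem_empty_iff_false,
        iff_false, not_not]
      exact ⟨NNReal.le_toNNReal_of_coe_le hr.1, Real.toNNReal_le_one.mpr hr.2⟩
    rw [this, measure_empty]
  · rw [integral_map hτ.aemeasurable (by fun_prop)]
    exact h (F.comp τ)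

/-- The functional calculus on bounded continuous functions, applied to the vector `v`. -/
def calcVec (hA : IsSelfAdjoint A) (v : K) : (ℝ≥0 →ᵇ ℂ) →ₗ[ℂ] K where
  toFun f := nnCalc hA f.toContinuousMap v
  map_add' f g := by
    have : (f + g).toContinuousMap = f.toContinuousMap + g.toContinuousMap := rfl
    rw [this, map_add, add_apply]
  map_smul' c f := by
    have : (c • f).toContinuousMap = c • f.toContinuousMap := rfl
    rw [this, map_smul, smul_apply, RingHom.id_apply]

theorem calcVec_one (hA : IsSelfAdjoint A) (v : K) : calcVec hA v 1 = v := by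
  change nnCalc hA 1 v = v
  rw [map_one]
  rfl

theorem inner_calcVec (hA : IsSelfAdjoint A) (v w : K) (f g : ℝ≥0 →ᵇ ℂ) :
    inner ℂ (calcVec hA v f) (calcVec hA w g) = inner ℂ (calcVec hA v (star g * f)) w :=
  (inner_starAlgHom_star_mul (nnCalc hA) g.toContinuousMap f.toContinuousMap v w).symm

theorem calcVec_minOne_mul (hA : IsSelfAdjoint A)
    (hs : spectrum ℂ A ⊆ Complex.ofReal '' Set.Icc (q : ℝ) 1) (v : K) (f : ℝ≥0 →ᵇ ℂ) :
    calcVec hA v (minOne * f) = A (calcVec hA v f) := by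
  change nnCalc hA (minOne.toContinuousMap * f.toContinuousMap) v = _
  rw [map_mul, nnCalc_minOne hA hs]
  rfl

/-- The cyclic subspace generated by `v`. -/
def cyclicSpan (hA : IsSelfAdjoint A) (v : K) : Submodule ℂ K :=
  (LinearMap.range (calcVec hA v)).topologicalClosure

theorem mem_cyclicSpan_self (hA : IsSelfAdjoint A) (v : K) : v ∈ cyclicSpan hA v :=
  Submodule.le_topologicalClosure _ ⟨1, calcVec_one hA v⟩

/-- A vector orthogonal to a cyclic subspace generates a cyclic subspace orthogonal to it. -/
theorem cyclicSpan_isOrtho (hA : IsSelfAdjoint A) {v w : K} (h : v ∈ (cyclicSpan hA w)ᗮ) :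
    cyclicSpan hA v ⟂ cyclicSpan hA w := by
  refine Submodule.topologicalClosure_minimal _ ?_ (Submodule.isClosed_orthogonal _)
  rw [cyclicSpan, Submodule.orthogonal_closure, ← Submodule.isOrtho_iff_le,
    Submodule.isOrtho_iff_inner_eq]
  rintro _ ⟨f, rfl⟩ _ ⟨g, rfl⟩
  rw [← inner_conj_symm, inner_calcVec, h _ (Submodule.le_topologicalClosure _ ⟨_, rfl⟩), map_zero]

/-- Every cyclic subspace is an `L²`-space on which the operator acts as multiplication by the
coordinate. -/
theorem exists_cyclic_isometry (hA : IsSelfAdjoint A)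
    (hs : spectrum ℂ A ⊆ Complex.ofReal '' Set.Icc (q : ℝ) 1)
    (hev : ¬ Module.End.HasEigenvalue (A : K →ₗ[ℂ] K) ((q : ℝ) : ℂ)) (v : K) :
    ∃ σ : Measure ℝ≥0, IsFiniteMeasure σ ∧ σ (Set.Ioc q 1)ᶜ = 0 ∧
      ∃ Φ : Lp ℂ 2 σ →ₗᵢ[ℂ] K, LinearMap.range Φ.toLinearMap = cyclicSpan hA v ∧
        ∀ g, A (Φ g) = Φ (mulOp σ g) := by
  obtain ⟨σ, hσ, hsupp, hnorm⟩ := exists_spectral_measure hA hs v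
  let e : (ℝ≥0 →ᵇ ℂ) →L[ℂ] Lp ℂ 2 σ := BoundedContinuousFunction.toLp 2 σ ℂ
  have hdense : DenseRange e :=
    BoundedContinuousFunction.toLp_denseRange ℂ σ ℂ (by norm_num)
  have he : ∀ f, e f =ᵐ[σ] f := fun f => BoundedContinuousFunction.coeFn_toLp 2 σ ℂ f
  -- By this equality `f ↦ f(A) v` extends from the dense image of the bounded continuous functions
  -- to an isometry of `L²(σ)`, whose closed range is the cyclic subspace.
  have hef : ∀ f, ‖calcVec hA v f‖ = ‖e f‖ := by
    intro f
    rw [← sq_eq_sq₀ (norm_nonneg _) (norm_nonneg _)]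
    refine (hnorm f.toContinuousMap).trans ?_
    have h1 : ((‖e f‖ ^ 2 : ℝ) : ℂ) = ∫ x, ((‖f x‖ ^ 2 : ℝ) : ℂ) ∂σ := by
      have := inner_self_eq_norm_sq_to_K (𝕜 := ℂ) (e f)
      rw [L2.inner_def] at this
      push_cast
      refine this.symm.trans (integral_congr_ae ?_)
      filter_upwards [he f] with x hx
      rw [hx, inner_self_eq_norm_sq_to_K]
      simp
    rw [integral_complex_ofReal] at h1
    exact (Complex.ofReal_injective h1).symm
  let Φ₀ : Lp ℂ 2 σ →L[ℂ] K := (calcVec hA v).extendOfNorm e.toLinearMap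
  have hΦ₀ : ∀ f, Φ₀ (e f) = calcVec hA v f := fun f =>
    LinearMap.extendOfNorm_eq (e := e.toLinearMap) hdense
      ⟨1, fun f => by rw [one_mul]; exact (hef f).le⟩ f
  let Φ : Lp ℂ 2 σ →ₗᵢ[ℂ] K :=
    { Φ₀.toLinearMap with
      norm_map' := fun g => by
        refine hdense.induction_on (p := fun g => ‖Φ₀ g‖ = ‖g‖) g
          (isClosed_eq (by fun_prop) (by fun_prop)) fun f => ?_
        rw [hΦ₀, hef] }
  have hΦ : ∀ f, Φ (e f) = calcVec hA v f := hΦ₀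
  have hmul : ∀ g, A (Φ g) = Φ (mulOp σ g) := by
    intro g
    refine hdense.induction_on (p := fun g => A (Φ g) = Φ (mulOp σ g)) g
      (isClosed_eq (A.continuous.comp Φ.continuous)
        (Φ.continuous.comp (mulOp σ).continuous)) fun f => ?_
    have : mulOp σ (e f) = e (minOne * f) := by
      refine Lp.ext ?_
      filter_upwards [mulOp_coe (e f), he f, he (minOne * f)] with x h1 h2 h3
      rw [h1, h2, h3]
      rfl
    rw [this, hΦ, hΦ, calcVec_minOne_mul hA hs]
  -- The indicator of `{q}` is multiplied by `min q 1`; if it were nonzero in `L²(σ)`, its image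
  -- would be an eigenvector of `A` for the eigenvalue `q`.
  have hq : σ {q} = 0 := by
    have hm : MemLp (Set.indicator {q} fun _ => (1 : ℂ)) 2 σ :=
      memLp_indicator_const 2 (measurableSet_singleton q) 1 (Or.inr (measure_ne_top _ _))
    set g := hm.toLp with hg
    have h1 : mulOp σ g = ((min q 1 : ℝ≥0) : ℂ) • g := by
      refine Lp.ext ?_
      filter_upwards [mulOp_coe g, hm.coeFn_toLp, Lp.coeFn_smul ((min q 1 : ℝ≥0) : ℂ) g]
        with x h1 h2 h3
      rw [h1, h3, Pi.smul_apply, smul_eq_mul, h2]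
      by_cases hx : x ∈ ({q} : Set ℝ≥0)
      · rw [Set.mem_singleton_iff.mp hx]
      · rw [Set.indicator_of_notMem hx, mul_zero, mul_zero]
    have h2 : g = 0 := by
      by_contra hg0
      have hne : Φ g ≠ 0 := fun h => hg0 (Φ.injective (h.trans (map_zero Φ).symm))
      -- For `q > 1` the spectrum would be empty, which is impossible on a nonzero space.
      have hq1 : q ≤ 1 := by
        by_contra! hc
        have : spectrum ℂ A = ∅ := Set.subset_empty_iff.mp (hs.trans (by
          rw [Set.Icc_eq_empty (by exact_mod_cast hc.not_ge), Set.image_empty]))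
        have hnt : Nontrivial K := ⟨Φ g, 0, hne⟩
        exact (spectrum.nonempty A).ne_empty this
      refine hev (Module.End.hasEigenvalue_of_hasEigenvector (x := Φ g)
        ⟨Module.End.mem_eigenspace_iff.mpr ?_, hne⟩)
      change A (Φ g) = _
      rw [hmul, h1, min_eq_left hq1, map_smul]
    have h3 : g =ᵐ[σ] 0 := by rw [h2]; exact Lp.coeFn_zero ℂ 2 σ
    have h4 : ∀ᵐ x ∂σ, x ∉ ({q} : Set ℝ≥0) := by
      filter_upwards [h3, hm.coeFn_toLp] with x h5 h6 hx
      rw [h5, Set.indicator_of_mem hx] at h6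
      simp at h6
    simpa [ae_iff] using h4
  refine ⟨σ, hσ, ?_, Φ, ?_, hmul⟩
  · refine measure_mono_null (t := (Set.Icc q 1)ᶜ ∪ {q}) ?_ (measure_union_null hsupp hq)
    intro x hx
    by_contra hc
    simp only [Set.mem_union, Set.mem_compl_iff, not_or, not_not] at hc
    exact hx ⟨lt_of_le_of_ne hc.1.1 (Ne.symm hc.2), hc.1.2⟩
  · refine le_antisymm ?_ ?_
    · rintro _ ⟨g, rfl⟩
      refine hdense.induction_on (p := fun g => Φ g ∈ cyclicSpan hA v) g
        ((Submodule.isClosed_topologicalClosure _).preimage Φ.continuous) fun f => ?_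
      rw [hΦ]
      exact Submodule.le_topologicalClosure _ ⟨f, rfl⟩
    · refine Submodule.topologicalClosure_minimal _ ?_
        Φ.isometry.isUniformInducing.isComplete_range.isClosed
      rintro _ ⟨f, rfl⟩
      exact ⟨e f, hΦ f⟩

/-- Zorn's lemma gives a maximal set of vectors with mutually orthogonal cyclic subspaces. A vector
`w` orthogonal to all of them can be adjoined, so it already belongs to the set; it is then
orthogonal to its own cyclic subspace, which contains it, and `w = 0`. -/
theorem exists_orthogonal_cyclicSpans (hA : IsSelfAdjoint A) :
    ∃ S : Set K, S.Pairwise (fun v w => cyclicSpan hA v ⟂ cyclicSpan hA w) ∧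
      (⨆ v : S, cyclicSpan hA v).topologicalClosure = ⊤ := by
  obtain ⟨S, hS⟩ := zorn_subset
    {S : Set K | S.Pairwise fun v w => cyclicSpan hA v ⟂ cyclicSpan hA w} fun c hc hchain =>
      ⟨⋃₀ c, (Set.pairwise_sUnion hchain.directedOn).mpr hc, fun s hs => Set.subset_sUnion_of_mem hs⟩
  refine ⟨S, hS.prop, ?_⟩
  rw [Submodule.topologicalClosure_eq_top_iff, Submodule.eq_bot_iff]
  intro w hw
  have hw' : ∀ v ∈ S, w ∈ (cyclicSpan hA v)ᗮ := fun v hv =>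
    Submodule.orthogonal_le (le_iSup (fun v : S => cyclicSpan hA (v : K)) ⟨v, hv⟩) hw
  have hmem : w ∈ S := by
    refine hS.le_of_ge (y := insert w S) ?_ (Set.subset_insert w S) (Set.mem_insert w S)
    refine (Set.pairwise_insert).mpr ⟨hS.prop, fun v hv _ => ?_⟩
    exact ⟨cyclicSpan_isOrtho hA (hw' v hv), (cyclicSpan_isOrtho hA (hw' v hv)).symm⟩
  have := hw' w hmem w (mem_cyclicSpan_self hA w)
  exact inner_self_eq_zero.mp this

end Spectral

/-! ### The `q`-invariant extension of a measure on `(q, 1]` -/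

section Extension

variable {q : ℝ≥0} {σ : Measure ℝ≥0}

theorem ae_zpow_mul_notMem (hq0 : 0 < q) (hq1 : q < 1) (hσ : σ (Set.Ioc q 1)ᶜ = 0) {k : ℤ}
    (hk : k ≠ 0) : ∀ᵐ x ∂σ, q ^ k * x ∉ Set.Ioc q 1 := by
  have h : ∀ᵐ x ∂σ, x ∈ Set.Ioc q 1 := by rw [ae_iff]; exact hσ
  filter_upwards [h] with x hx hx'
  exact hk (zpow_eq_zero_of_mem_Ioc hq0 hq1 hx hx')

/-- `∑ σ(q^{-k} M)` -/
def invSum (q : ℝ≥0) (σ : Measure ℝ≥0) : Measure ℝ≥0 :=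
  Measure.sum fun k : ℤ => σ.map fun x => q ^ k * x

theorem invSum_apply {M : Set ℝ≥0} (hM : MeasurableSet M) :
    invSum q σ M = ∑' k : ℤ, σ {x | q ^ k * x ∈ M} := by
  rw [invSum, Measure.sum_apply _ hM]
  exact tsum_congr fun k => Measure.map_apply (measurable_const_mul _) hM

/-- The images of `(q, 1]` under distinct powers of `q` are disjoint, so a set inside one of them is
seen by a single term of the sum. -/
theorem invSum_apply_of_subset (hq0 : 0 < q) (hq1 : q < 1) (hσ : σ (Set.Ioc q 1)ᶜ = 0)
    {M : Set ℝ≥0} (hM : MeasurableSet M) {k : ℤ} (h : M ⊆ (fun x => q ^ k * x) ⁻¹' Set.Ioc q 1) :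
    invSum q σ M = σ {x | q ^ (-k) * x ∈ M} := by
  rw [invSum_apply hM]
  refine tsum_eq_single (-k) fun j hj => ?_
  have := ae_zpow_mul_notMem hq0 hq1 hσ (k := k + j) (by omega)
  rw [ae_iff] at this
  refine measure_mono_null ?_ this
  intro x hx
  have := h hx
  rw [Set.mem_preimage, ← mul_assoc, ← zpow_add₀ hq0.ne'] at this
  exact not_not.mpr this

/-- The measure is the sum of all translates of `σ` under powers of `q`. Invariance is a shift of
the summation index; `σ`-finiteness holds because each translate of `(q, 1]` has finite mass, and
these sets together with the null set `{0}` cover `[0,∞)`. -/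
theorem exists_qInvMeasure (hq0 : 0 < q) (hq1 : q < 1) [IsFiniteMeasure σ]
    (hσ : σ (Set.Ioc q 1)ᶜ = 0) : ∃ N : QInvMeasure q, N.ν.restrict (Set.Ioc q 1) = σ := by
  have hae : ∀ᵐ x ∂σ, x ∈ Set.Ioc q 1 := by rw [ae_iff]; exact hσ
  have h0 : invSum q σ {0} = 0 := by
    rw [invSum_apply (measurableSet_singleton 0), ENNReal.tsum_eq_zero]
    intro k
    refine measure_mono_null ?_ hσ
    intro x hx hx'
    have : q ^ k * x = 0 := hx
    exact (mul_pos (zpow_pos hq0 k) (hq0.trans hx'.1)).ne' this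
  refine ⟨⟨invSum q σ, ?_, ?_, h0⟩, ?_⟩
  · refine Measure.sigmaFinite_of_countable
      (S := insert {0} (Set.range fun k : ℤ => (fun x => q ^ k * x) ⁻¹' Set.Ioc q 1))
      ((Set.countable_range _).insert _) ?_ ?_
    · rintro s (rfl | ⟨k, rfl⟩)
      · simp [h0]
      · rw [invSum_apply_of_subset hq0 hq1 hσ (k := k)
          (measurableSet_Ioc.preimage (measurable_const_mul _)) subset_rfl]
        exact measure_lt_top σ _
    · refine Set.eq_univ_of_forall fun x => ?_
      by_cases hx : x = 0
      · exact ⟨{0}, Set.mem_insert _ _, hx⟩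
      · obtain ⟨i, hi⟩ := exists_mem_cellSet hq0 hq1 ((fun l => l.elim0, x) : X q 0) hx
        exact ⟨_, Set.mem_insert_of_mem _ ⟨i.2, rfl⟩, hi.2⟩
  · intro M hM
    have hinj : Function.Injective fun t : ℝ≥0 => q * t := mul_right_injective₀ hq0.ne'
    have himg : MeasurableSet ((fun t => q * t) '' M) :=
      (MeasurableEquiv.mulLeft₀ q hq0.ne').measurableEmbedding.measurableSet_image.mpr hM
    rw [invSum_apply himg, invSum_apply hM, ← (Equiv.addRight (1 : ℤ)).tsum_eq]
    refine tsum_congr fun k => ?_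
    congr 1
    ext x
    change q ^ (k + 1) * x ∈ (fun t => q * t) '' M ↔ q ^ k * x ∈ M
    rw [add_comm k, zpow_add₀ hq0.ne', zpow_one, mul_assoc]
    exact hinj.mem_set_image (s := M)
  · ext M hM
    rw [Measure.restrict_apply hM, invSum_apply_of_subset hq0 hq1 hσ (hM.inter measurableSet_Ioc)
      (k := 0) (fun x hx => by simpa using hx.2)]
    refine measure_congr ?_
    filter_upwards [hae] with x hx
    refine propext ?_
    change q ^ (-0 : ℤ) * x ∈ M ∩ Set.Ioc q 1 ↔ x ∈ M
    rw [neg_zero, zpow_zero, one_mul]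
    exact and_iff_left hx

end Extension

/-! ### Graphs of orthogonal sums -/

section Sums

theorem mem_graph_zeroSum {H : Type u} [NormedAddCommGroup H] [InnerProductSpace ℂ H]
    {F : Type v} [NormedAddCommGroup F] [InnerProductSpace ℂ F] {T : F →ₗ.[ℂ] F}
    {x y : WithLp 2 (H × F)} :
    (x, y) ∈ (zeroSum H T).graph ↔ y.fst = 0 ∧ (x.snd, y.snd) ∈ T.graph := by
  simp only [LinearPMap.mem_graph_iff]
  constructor
  · rintro ⟨z, hz, hy⟩
    subst hz hy
    exact ⟨rfl, ⟨z.1.snd, z.2⟩, rfl, rfl⟩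
  · rintro ⟨h, z, hz, hy⟩
    refine ⟨⟨x, show x.snd ∈ T.domain from hz ▸ z.2⟩, rfl, ?_⟩
    refine WithLp.ofLp_injective 2 (Prod.ext h.symm ?_)
    refine Eq.trans ?_ hy
    change T ⟨x.snd, _⟩ = T z
    congr 1
    exact Subtype.ext hz.symm

variable {ι : Type v} {E : ι → Type u} [∀ i, NormedAddCommGroup (E i)]
  [∀ i, InnerProductSpace ℂ (E i)]

/-- The summability condition in the domain is contained in `y` being an element of `lp E 2`; what
remains is a condition on each coordinate. -/
theorem mem_graph_hilbertSum {T : ∀ i, E i →ₗ.[ℂ] E i} {x y : lp E 2} :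
    (x, y) ∈ (hilbertSum T).graph ↔ ∀ i, (x i, y i) ∈ (T i).graph := by
  constructor
  · intro h i
    obtain ⟨z, hz, hy⟩ := LinearPMap.mem_graph_iff _ |>.mp h
    subst hz
    rw [LinearPMap.mem_graph_iff]
    exact ⟨⟨z.1 i, z.2.1 i⟩, rfl, congrFun (congrArg Subtype.val hy) i⟩
  · intro h
    have hd : ∀ i, x i ∈ (T i).domain := fun i => LinearPMap.mem_domain_of_mem_graph (h i)
    have hT : (fun i => T i ⟨x i, hd i⟩) = y :=
      funext fun i => ((T i).image_iff (hd i)).mpr (h i) |>.symm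
    rw [LinearPMap.mem_graph_iff]
    refine ⟨⟨x, hd, ?_⟩, rfl, ?_⟩
    · rw [hT]; exact lp.memℓp y
    · exact lp.ext hT

/-- `lp.single` as a linear isometry. -/
def lpSingle [DecidableEq ι] (E : ι → Type u) [∀ i, NormedAddCommGroup (E i)]
    [∀ i, InnerProductSpace ℂ (E i)] (i : ι) : E i →ₗᵢ[ℂ] lp E 2 where
  toLinearMap := lp.lsingle 2 i
  norm_map' := lp.norm_single (by norm_num) i

@[simp]
theorem lpSingle_apply [DecidableEq ι] (i : ι) (a : E i) : lpSingle E i a = lp.single 2 i a := rfl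

theorem inner_single_of_ne [DecidableEq ι] {i j : ι} (h : i ≠ j) (a : E i) (b : E j) :
    inner ℂ (lp.single (E := E) 2 i a) (lp.single 2 j b) = 0 := by
  rw [lp.inner_single_left, lp.single_apply_ne _ _ _ h, inner_zero_right]

/-- The map `(a, b) ↦ (single i a, single i b)` on graphs. -/
def singlePair [DecidableEq ι] (E : ι → Type u) [∀ i, NormedAddCommGroup (E i)]
    [∀ i, InnerProductSpace ℂ (E i)] (i : ι) : (E i × E i) →L[ℂ] (lp E 2 × lp E 2) :=
  (lpSingle E i).toContinuousLinearMap.prodMap (lpSingle E i).toContinuousLinearMap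

/-- Reduces an orthogonal sum of closed operators to pairs living in one summand: every pair in the
graph is the sum of its components, and the coordinatewise description shows that the graph is
closed. -/
theorem graph_hilbertSum [DecidableEq ι] {T : ∀ i, E i →ₗ.[ℂ] E i} {s : ∀ i, Set (E i × E i)}
    (h : ∀ i, (T i).graph = (Submodule.span ℂ (s i)).topologicalClosure) :
    (hilbertSum T).graph =
      (Submodule.span ℂ (⋃ i, singlePair E i '' s i)).topologicalClosure := by
  refine le_antisymm ?_ ?_
  · rintro ⟨x, y⟩ hxy
    rw [mem_graph_hilbertSum] at hxy
    have hsum : HasSum (fun i => singlePair E i (x i, y i)) (x, y) :=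
      (lp.hasSum_single (by norm_num) x).prodMk (lp.hasSum_single (by norm_num) y)
    refine (Submodule.isClosed_topologicalClosure _).mem_of_tendsto hsum
      (Eventually.of_forall fun S => Submodule.sum_mem _ fun i _ => ?_)
    have hle : Submodule.span ℂ (s i) ≤
        ((Submodule.span ℂ (⋃ i, singlePair E i '' s i)).topologicalClosure).comap
          (singlePair E i).toLinearMap := by
      rw [Submodule.span_le]
      exact fun p hp => Submodule.le_topologicalClosure _
        (Submodule.subset_span (Set.mem_iUnion.mpr ⟨i, p, hp, rfl⟩))
    have hxi := hxy i
    rw [h i] at hxi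
    exact Submodule.topologicalClosure_minimal _ hle
      ((Submodule.isClosed_topologicalClosure _).preimage (singlePair E i).continuous) hxi
  · refine Submodule.topologicalClosure_minimal _ ?_ ?_
    · rw [Submodule.span_le]
      intro p hp
      obtain ⟨i, ⟨a, b⟩, hab, rfl⟩ := Set.mem_iUnion.mp hp
      change (lp.single (E := E) 2 i a, lp.single (E := E) 2 i b) ∈ (hilbertSum T).graph
      rw [mem_graph_hilbertSum]
      intro j
      by_cases hj : j = i
      · subst hj
        rw [lp.single_apply_self, lp.single_apply_self, h j]
        exact Submodule.le_topologicalClosure _ (Submodule.subset_span hab)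
      · rw [lp.single_apply_ne _ _ _ hj, lp.single_apply_ne _ _ _ hj]
        exact (T j).graph.zero_mem
    · have : ((hilbertSum T).graph : Set (lp E 2 × lp E 2)) =
          ⋂ i, (fun p : lp E 2 × lp E 2 => (p.1 i, p.2 i)) ⁻¹' ((T i).graph : Set (E i × E i)) := by
        ext ⟨x, y⟩
        rw [Set.mem_iInter]
        exact mem_graph_hilbertSum
      rw [this]
      refine isClosed_iInter fun i => ?_
      rw [h i]
      refine (Submodule.isClosed_topologicalClosure _).preimage ?_
      have hc : Continuous fun z : lp E 2 => z i := (lp.evalCLM ℂ E 2 i).continuous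
      exact (hc.comp continuous_fst).prodMk (hc.comp continuous_snd)

theorem mem_closure_span_image_iff {X : Type u} {Y : Type v} [NormedAddCommGroup X]
    [NormedSpace ℂ X] [NormedAddCommGroup Y] [NormedSpace ℂ Y] (W : X ≃L[ℂ] Y) (s : Set X)
    (x : X) : W x ∈ (Submodule.span ℂ (W '' s)).topologicalClosure ↔
      x ∈ (Submodule.span ℂ s).topologicalClosure := by
  have h1 : Submodule.span ℂ (W '' s) = (Submodule.span ℂ s).map W.toLinearMap :=
    (Submodule.map_span W.toLinearMap s).symm
  have h2 : ((Submodule.span ℂ (W '' s)).topologicalClosure : Set Y) =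
      W '' ((Submodule.span ℂ s).topologicalClosure : Set X) := by
    rw [h1, Submodule.topologicalClosure_coe, Submodule.topologicalClosure_coe,
      W.image_closure]
    rfl
  rw [← SetLike.mem_coe, h2, W.injective.mem_set_image, SetLike.mem_coe]

theorem isHilbertSum_of_forall_inner {B : Type v} {G : B → Type w}
    [∀ b, NormedAddCommGroup (G b)] [∀ b, InnerProductSpace ℂ (G b)] [∀ b, CompleteSpace (G b)]
    {F : Type u} [NormedAddCommGroup F] [InnerProductSpace ℂ F] [CompleteSpace F]
    {V : ∀ b, G b →ₗᵢ[ℂ] F} (hV : OrthogonalFamily ℂ G V)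
    (h : ∀ x, (∀ b g, inner ℂ (V b g) x = 0) → x = 0) : IsHilbertSum ℂ G V := by
  refine IsHilbertSum.mk hV ?_
  rw [top_le_iff, Submodule.topologicalClosure_eq_top_iff, Submodule.eq_bot_iff]
  refine fun x hx => h x fun b g => hx _ ?_
  exact Submodule.mem_iSup_of_mem b ⟨g, rfl⟩

end Sums

/-! ### Graphs of weighted shifts -/

section ShiftGraphs

variable {G : Type u} [NormedAddCommGroup G] [InnerProductSpace ℂ G]
  {E : Type v} [NormedAddCommGroup E] [InnerProductSpace ℂ E]

/-- The elements of the graph of a weighted shift that live on a single component. -/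
def shiftPairs (q : ℝ) (m : ℕ) (A : G →ₗ[ℂ] G) (V : Idx m → G →ₗᵢ[ℂ] E) (j : ℕ) : Set (E × E) :=
  {p | ∃ i g, p = (V i g, V (raiseIdx m j i) ((stdCoef q m j i : ℂ) • A g))}

variable {q : ℝ} {m : ℕ} {A : G →ₗ[ℂ] G} {V : Idx m → G →ₗᵢ[ℂ] E}

theorem graph_eq_span_shiftPairs {T : E →ₗ.[ℂ] E} {j : ℕ}
    (hdom : T.domain = LinearMap.range (sumMap V))
    (hT : ∀ p : Idx m →₀ G, (sumMap V p, sumMap V (raiseShift q m A j p)) ∈ T.graph) :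
    T.graph = Submodule.span ℂ (shiftPairs q m A V j) := by
  refine le_antisymm ?_ ?_
  · rintro ⟨x, y⟩ hxy
    have hx := LinearPMap.mem_domain_of_mem_graph hxy
    rw [hdom] at hx
    obtain ⟨p, rfl⟩ := hx
    have hy : y = sumMap V (raiseShift q m A j p) :=
      T.mem_graph_snd_inj' hxy (hT p) rfl
    rw [hy]
    clear hy hxy
    induction p using Finsupp.induction_linear with
    | zero => simp only [map_zero]; exact Submodule.zero_mem _
    | add x y hx hy => simp only [map_add]; exact Submodule.add_mem _ hx hy
    | single i g =>
      rw [raiseShift_single, sumMap_single, sumMap_single]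
      exact Submodule.subset_span ⟨i, g, rfl⟩
  · rw [Submodule.span_le]
    rintro _ ⟨i, g, rfl⟩
    have := hT (Finsupp.single i g)
    rwa [raiseShift_single, sumMap_single, sumMap_single] at this

end ShiftGraphs

/-! ### The operators of part (b) as weighted shifts -/

section StandardGraphs

variable {K : Type u} [NormedAddCommGroup K] [InnerProductSpace ℂ K] {q : ℝ} {m : ℕ}

theorem stdOp_single (A : K →L[ℂ] K) (j : ℕ) (i : Idx m) (h : K) :
    (lp.single 2 i h, lp.single 2 (raiseIdx m j i) ((stdCoef q m j i : ℂ) • A h)) ∈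
      (stdOp q m A j).graph := by
  rw [LinearPMap.mem_graph_iff]
  refine ⟨⟨lp.single 2 i h, ?_⟩, rfl, ?_⟩
  · refine (Set.finite_singleton i).subset fun i' hi' => ?_
    by_contra hc
    exact hi' (lp.single_apply_ne _ _ _ hc)
  · change ∑ᶠ i' : Idx m, lp.single (E := fun _ : Idx m => K) 2 (raiseIdx m j i')
        ((stdCoef q m j i' : ℂ) • A (lp.single (E := fun _ : Idx m => K) 2 i h i')) = _
    rw [finsum_eq_single _ i]
    · rw [lp.single_apply_self]
    · intro i' hi'
      rw [lp.single_apply_ne _ _ _ hi', map_zero, smul_zero, lp.single_zero]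

theorem stdDomain_eq_range (m : ℕ) (K : Type u) [NormedAddCommGroup K] [InnerProductSpace ℂ K] :
    stdDomain m K = LinearMap.range (sumMap (lpSingle fun _ : Idx m => K)) := by
  refine le_antisymm ?_ ?_
  · intro x hx
    have hx' : {i | x i ≠ 0}.Finite := hx
    refine ⟨∑ i ∈ hx'.toFinset, Finsupp.single i (x i), ?_⟩
    rw [map_sum]
    simp only [sumMap_single, lpSingle_apply]
    refine lp.ext (funext fun i => ?_)
    rw [lp.coeFn_sum, Finset.sum_apply]
    simp only [lp.coeFn_single]
    rw [Finset.sum_pi_single]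
    split_ifs with h
    · rfl
    · simpa using Eq.symm (by simpa using h)
  · rintro _ ⟨p, rfl⟩
    induction p using Finsupp.induction_linear with
    | zero => simp
    | add x y hx hy => rw [map_add]; exact Submodule.add_mem _ hx hy
    | single i h =>
      rw [sumMap_single]
      -- The parameters of the operator are arbitrary here, as its domain does not depend on them.
      exact LinearPMap.mem_domain_of_mem_graph (stdOp_single (q := 1) 0 0 i h)

theorem stdOp_sumMap (A : K →L[ℂ] K) (j : ℕ) (p : Idx m →₀ K) :
    (sumMap (lpSingle fun _ : Idx m => K) p,
      sumMap (lpSingle fun _ : Idx m => K) (raiseShift q m A.toLinearMap j p)) ∈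
      (stdOp q m A j).graph := by
  induction p using Finsupp.induction_linear with
  | zero => simp only [map_zero]; exact (stdOp q m A j).graph.zero_mem
  | add x y hx hy => simpa only [map_add] using! (stdOp q m A j).graph.add_mem hx hy
  | single i h =>
    rw [raiseShift_single, sumMap_single, sumMap_single]
    exact stdOp_single A j i h

theorem dense_stdDomain : Dense (stdDomain m K : Set (StdSpace m K)) := by
  rw [Submodule.dense_iff_topologicalClosure_eq_top, eq_top_iff]
  intro x _
  refine (Submodule.isClosed_topologicalClosure _).mem_of_tendsto
    (lp.hasSum_single (by norm_num) x) (Eventually.of_forall fun S => ?_)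
  refine Submodule.le_topologicalClosure _ (Submodule.sum_mem _ fun i _ => ?_)
  rw [stdDomain_eq_range]
  exact ⟨Finsupp.single i (x i), by simp⟩

theorem orthogonalFamily_lpSingle :
    OrthogonalFamily ℂ (fun _ : Idx m => K) (lpSingle fun _ : Idx m => K) :=
  fun _ _ h a b => inner_single_of_ne (E := fun _ : Idx m => K) h a b

theorem stdOp_isClosable [CompleteSpace K] (hq0 : 0 < q) (hq1 : q < 1) {A : K →L[ℂ] K}
    (hA : IsSelfAdjoint A) {n : ℕ} (hm : m < n) (j : Fin n) :
    (stdOp q m A j).IsClosable :=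
  (isStarRep_of_shift (A := A.toLinearMap) hq0 hq1 hm orthogonalFamily_lpSingle
    (fun g g' => hA.isSymmetric g g') (stdDomain_eq_range m K) dense_stdDomain
    (fun j : Fin n => stdOp q m A j) (fun _ => rfl) (fun j p => stdOp_sumMap A j p)).1 j

end StandardGraphs

/-! ### The classified representations as sums of concrete ones -/

section Decomposition

variable {q : ℝ≥0}

/-- The space `L²((q, 1], ν)`. -/
abbrev CellL2 (N : QInvMeasure q) : Type := Lp ℂ 2 (N.ν.restrict (Set.Ioc q 1))

/-- A self-adjoint operator with spectrum in `[q, 1]` of which `q` is not an eigenvalue is an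
orthogonal sum of multiplication operators on spaces `L²((q, 1], ν)`. -/
theorem exists_cell_decomposition (hq0 : 0 < q) (hq1 : q < 1) {K : Type u}
    [NormedAddCommGroup K] [InnerProductSpace ℂ K] [CompleteSpace K] {A : K →L[ℂ] K}
    (hA : IsSelfAdjoint A) (hs : spectrum ℂ A ⊆ Complex.ofReal '' Set.Icc (q : ℝ) 1)
    (hev : ¬ Module.End.HasEigenvalue (A : K →ₗ[ℂ] K) ((q : ℝ) : ℂ)) :
    ∃ (S : Set K) (N : S → QInvMeasure q) (Φ : ∀ v : S, CellL2 (N v) →ₗᵢ[ℂ] K),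
      OrthogonalFamily ℂ (fun v => CellL2 (N v)) Φ ∧
      (⨆ v, LinearMap.range (Φ v).toLinearMap).topologicalClosure = ⊤ ∧
      ∀ v g, A (Φ v g) = Φ v (mulOp _ g) := by
  obtain ⟨S, hS, htop⟩ := exists_orthogonal_cyclicSpans hA
  have h : ∀ v : S, ∃ (N : QInvMeasure q) (Φ : CellL2 N →ₗᵢ[ℂ] K),
      LinearMap.range Φ.toLinearMap = cyclicSpan hA v ∧ ∀ g, A (Φ g) = Φ (mulOp _ g) := by
    intro v
    obtain ⟨σ, hσ, hsupp, Φ, hΦ⟩ := exists_cyclic_isometry hA hs hev v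
    obtain ⟨N, rfl⟩ := exists_qInvMeasure hq0 hq1 hsupp
    exact ⟨N, Φ, hΦ⟩
  choose N Φ hrange hmul using h
  refine ⟨S, N, Φ, fun v w hvw a b => ?_, ?_, hmul⟩
  · have : cyclicSpan hA v ⟂ cyclicSpan hA w := hS v.2 w.2 (Subtype.coe_injective.ne hvw)
    rw [Submodule.isOrtho_iff_inner_eq] at this
    refine this _ ?_ _ ?_
    · rw [← hrange]; exact ⟨a, rfl⟩
    · rw [← hrange]; exact ⟨b, rfl⟩
  · simp only [hrange]
    exact htop

theorem eq_zero_of_forall_inner {K : Type u} [NormedAddCommGroup K] [InnerProductSpace ℂ K]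
    [CompleteSpace K] {S : Type v} {G : S → Type w} [∀ v, NormedAddCommGroup (G v)]
    [∀ v, InnerProductSpace ℂ (G v)] {Φ : ∀ v, G v →ₗᵢ[ℂ] K}
    (htop : (⨆ v, LinearMap.range (Φ v).toLinearMap).topologicalClosure = ⊤) {x : K}
    (h : ∀ v g, inner ℂ (Φ v g) x = 0) : x = 0 := by
  rw [Submodule.topologicalClosure_eq_top_iff, Submodule.eq_bot_iff] at htop
  refine htop x fun y hy => ?_
  have hle : (⨆ v, LinearMap.range (Φ v).toLinearMap) ≤ (ℂ ∙ x)ᗮ := by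
    refine iSup_le fun v => ?_
    rintro _ ⟨g, rfl⟩
    rw [Submodule.mem_orthogonal_singleton_iff_inner_left]
    exact h v g
  exact (Submodule.mem_orthogonal_singleton_iff_inner_left).mp (hle hy)

/-- Vectors from the ranges of the `Φ v` suffice to generate the graph: since `A` is bounded, `h`
and the corresponding pair in the graph depend continuously on each other through the map `P` below,
and these ranges span a dense subspace of `K`. -/
theorem graph_closure_stdOp {K : Type u} [NormedAddCommGroup K] [InnerProductSpace ℂ K]
    [CompleteSpace K] (hq0 : 0 < q) (hq1 : q < 1) {A : K →L[ℂ] K} (hA : IsSelfAdjoint A)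
    {S : Type v} {N : S → QInvMeasure q} {Φ : ∀ v : S, CellL2 (N v) →ₗᵢ[ℂ] K}
    (htop : (⨆ v, LinearMap.range (Φ v).toLinearMap).topologicalClosure = ⊤)
    (hmul : ∀ v g, A (Φ v g) = Φ v (mulOp _ g)) {n m : ℕ} (hm : m < n) (j : Fin n) :
    (stdOp (q : ℝ) m A j).closure.graph = (Submodule.span ℂ
      (⋃ v, shiftPairs (q : ℝ) m (mulOp _).toLinearMap
        (fun i => (lpSingle (fun _ : Idx m => K) i).comp (Φ v)) j)).topologicalClosure := by
  have hq0' : (0 : ℝ) < q := by exact_mod_cast hq0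
  have hq1' : (q : ℝ) < 1 := by exact_mod_cast hq1
  rw [← (stdOp_isClosable hq0' hq1' hA hm j).graph_closure_eq_closure_graph,
    graph_eq_span_shiftPairs (A := A.toLinearMap) (stdDomain_eq_range m K) (stdOp_sumMap A j)]
  refine le_antisymm ?_ ?_
  · refine Submodule.topologicalClosure_minimal _ ?_ (Submodule.isClosed_topologicalClosure _)
    rw [Submodule.span_le]
    rintro _ ⟨i, h, rfl⟩
    let P : K →L[ℂ] StdSpace m K × StdSpace m K :=
      (lpSingle (fun _ : Idx m => K) i).toContinuousLinearMap.prod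
        ((lpSingle (fun _ : Idx m => K) (raiseIdx m j i)).toContinuousLinearMap ∘L
          ((stdCoef (q : ℝ) m j i : ℂ) • A))
    have hle : (⨆ v, LinearMap.range (Φ v).toLinearMap) ≤ (Submodule.span ℂ
      (⋃ v, shiftPairs (q : ℝ) m (mulOp _).toLinearMap
        (fun i => (lpSingle (fun _ : Idx m => K) i).comp (Φ v)) j)).topologicalClosure.comap
          P.toLinearMap := by
      refine iSup_le fun v => ?_
      rintro _ ⟨g, rfl⟩
      refine Submodule.le_topologicalClosure _
        (Submodule.subset_span (Set.mem_iUnion.mpr ⟨v, i, g, ?_⟩))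
      change (lpSingle (fun _ : Idx m => K) i (Φ v g),
        lpSingle (fun _ : Idx m => K) (raiseIdx m j i) ((stdCoef (q : ℝ) m j i : ℂ) • A (Φ v g))) =
        (lpSingle (fun _ : Idx m => K) i (Φ v g), lpSingle (fun _ : Idx m => K) (raiseIdx m j i)
          (Φ v ((stdCoef (q : ℝ) m j i : ℂ) • mulOp _ g)))
      rw [hmul, map_smul (Φ v)]
    have := Submodule.topologicalClosure_minimal _ hle
      ((Submodule.isClosed_topologicalClosure _).preimage P.continuous)
    rw [htop] at this
    exact this (Submodule.mem_top (x := h))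
  · refine Submodule.topologicalClosure_mono (Submodule.span_mono ?_)
    refine Set.iUnion_subset fun v => ?_
    rintro _ ⟨i, g, rfl⟩
    refine ⟨i, Φ v g, ?_⟩
    change (lpSingle (fun _ : Idx m => K) i (Φ v g), lpSingle (fun _ : Idx m => K) (raiseIdx m j i)
          (Φ v ((stdCoef (q : ℝ) m j i : ℂ) • mulOp _ g))) =
        (lpSingle (fun _ : Idx m => K) i (Φ v g),
        lpSingle (fun _ : Idx m => K) (raiseIdx m j i) ((stdCoef (q : ℝ) m j i : ℂ) • A (Φ v g)))
    rw [hmul, map_smul (Φ v)]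

theorem graph_closure_concreteOp (hq0 : 0 < q) (hq1 : q < 1) {n m : ℕ} (hm : m < n)
    (N : QInvMeasure q) (j : Fin n) :
    (concreteOp m N j).closure.graph = (Submodule.span ℂ
      (shiftPairs (q : ℝ) m (mulOp _).toLinearMap (cellMap hq0 N) j)).topologicalClosure := by
  rw [← ((isStarRep_concreteOp hq0 hq1 hm N).1 j).graph_closure_eq_closure_graph,
    graph_eq_span_shiftPairs
      ((concreteOp_domain hq0 hq1 m N j).trans (compDomain_eq_range hq0 hq1 m N))
      (concreteOp_sumMap hq0 hq1 j)]

end Decomposition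

/-! ### Matching the summands of the two Hilbert spaces -/

section Unitary

variable {q : ℝ≥0} {n : ℕ} {K : Fin n → Type u} [∀ k, NormedAddCommGroup (K k)]
  [∀ k, InnerProductSpace ℂ (K k)] {S : Fin n → Type u}
  {N : ∀ k, S k → QInvMeasure q}

/-- The summands of the classified representations: the copy with index `b.2` of the cyclic
subspace with index `b.1`. -/
def stdIncl (Φ : ∀ k (v : S k), CellL2 (N k v) →ₗᵢ[ℂ] K k)
    (b : Σ a : (Σ k, S k), Idx (a.1 : ℕ)) :
    CellL2 (N b.1.1 b.1.2) →ₗᵢ[ℂ] lp (fun k : Fin n => StdSpace (k : ℕ) (K k)) 2 :=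
  (lpSingle (fun k : Fin n => StdSpace (k : ℕ) (K k)) b.1.1).comp
    ((lpSingle (fun _ : Idx b.1.1 => K b.1.1) b.2).comp (Φ b.1.1 b.1.2))

open Classical in
/-- The summands of a sum of concrete representations: the functions in the summand `b.1` that
live on the cell with index `b.2`. -/
def concreteIncl (hq0 : 0 < q) (N : ∀ k, S k → QInvMeasure q)
    (b : Σ a : (Σ k, S k), Idx (a.1 : ℕ)) :
    CellL2 (N b.1.1 b.1.2) →ₗᵢ[ℂ] lp (fun a : (Σ k, S k) => L2 (a.1 : ℕ) (N a.1 a.2)) 2 :=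
  (lpSingle (fun a : (Σ k, S k) => L2 (a.1 : ℕ) (N a.1 a.2)) b.1).comp
    (cellMap hq0 (N b.1.1 b.1.2) b.2)

variable {Φ : ∀ k (v : S k), CellL2 (N k v) →ₗᵢ[ℂ] K k}

theorem inner_stdIncl (b : Σ a : (Σ k, S k), Idx (a.1 : ℕ)) (g : CellL2 (N b.1.1 b.1.2))
    (x : lp (fun k : Fin n => StdSpace (k : ℕ) (K k)) 2) :
    inner ℂ (stdIncl Φ b g) x = inner ℂ (Φ b.1.1 b.1.2 g) (x b.1.1 b.2) := by
  change inner ℂ (lp.single (E := fun k : Fin n => StdSpace (k : ℕ) (K k)) 2 b.1.1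
    (lp.single (E := fun _ : Idx b.1.1 => K b.1.1) 2 b.2 (Φ b.1.1 b.1.2 g))) x = _
  rw [lp.inner_single_left, lp.inner_single_left]

open Classical in
theorem inner_concreteIncl (hq0 : 0 < q) (b : Σ a : (Σ k, S k), Idx (a.1 : ℕ))
    (g : CellL2 (N b.1.1 b.1.2))
    (x : lp (fun a : (Σ k, S k) => L2 (a.1 : ℕ) (N a.1 a.2)) 2) :
    inner ℂ (concreteIncl hq0 N b g) x = inner ℂ (cellMap hq0 (N b.1.1 b.1.2) b.2 g) (x b.1) :=
  lp.inner_single_left (G := fun a : (Σ k, S k) => L2 (a.1 : ℕ) (N a.1 a.2)) _ _ _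

theorem orthogonalFamily_stdIncl
    (horth : ∀ k, OrthogonalFamily ℂ (fun v => CellL2 (N k v)) (Φ k)) :
    OrthogonalFamily ℂ (fun b : Σ a : (Σ k, S k), Idx (a.1 : ℕ) => CellL2 (N b.1.1 b.1.2))
      (stdIncl Φ) := by
  rintro ⟨⟨k, v⟩, i⟩ ⟨⟨k', v'⟩, i'⟩ hne g g'
  rw [inner_stdIncl]
  change inner ℂ _ (lp.single (E := fun k : Fin n => StdSpace (k : ℕ) (K k)) 2 k'
    (lp.single (E := fun _ : Idx k' => K k') 2 i' (Φ k' v' g')) k i) = 0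
  by_cases hk : k = k'
  · subst hk
    rw [lp.single_apply_self]
    by_cases hi : i = i'
    · subst hi
      rw [lp.single_apply_self]
      refine horth k ?_ _ _
      rintro rfl
      exact hne rfl
    · rw [lp.single_apply_ne _ _ _ hi, inner_zero_right]
  · rw [lp.single_apply_ne _ _ _ hk]
    exact inner_zero_right _

theorem orthogonalFamily_concreteIncl (hq0 : 0 < q) (hq1 : q < 1) :
    OrthogonalFamily ℂ (fun b : Σ a : (Σ k, S k), Idx (a.1 : ℕ) => CellL2 (N b.1.1 b.1.2))
      (concreteIncl hq0 N) := by
  classical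
  rintro ⟨a, i⟩ ⟨a', i'⟩ hne g g'
  rw [inner_concreteIncl]
  by_cases ha : a = a'
  · subst ha
    have h : concreteIncl hq0 N ⟨a, i'⟩ g' a = cellMap hq0 (N a.1 a.2) i' g' :=
      lp.single_apply_self (E := fun a : (Σ k, S k) => L2 (a.1 : ℕ) (N a.1 a.2)) 2 a _
    rw [h]
    refine orthogonalFamily_cellMap hq0 hq1 _ _ ?_ _ _
    rintro rfl
    exact hne rfl
  · have h : concreteIncl hq0 N ⟨a', i'⟩ g' a = 0 :=
      lp.single_apply_ne (E := fun a : (Σ k, S k) => L2 (a.1 : ℕ) (N a.1 a.2)) 2 a' _ ha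
    rw [h, inner_zero_right]

theorem apply_eq_zero_iff [∀ k, CompleteSpace (K k)]
    (htop : ∀ k, (⨆ v, LinearMap.range (Φ k v).toLinearMap).topologicalClosure = ⊤)
    (x : lp (fun k : Fin n => StdSpace (k : ℕ) (K k)) 2) (k : Fin n) (i : Idx k) :
    x k i = 0 ↔ ∀ v g, inner ℂ (stdIncl Φ ⟨⟨k, v⟩, i⟩ g) x = 0 := by
  constructor
  · intro h v g
    rw [inner_stdIncl, h, inner_zero_right]
  · intro h
    exact eq_zero_of_forall_inner (htop k) fun v g =>
      (inner_stdIncl ⟨⟨k, v⟩, i⟩ g x).symm.trans (h v g)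

theorem vanishes_iff (hq0 : 0 < q) (b : Σ a : (Σ k, S k), Idx (a.1 : ℕ))
    (x : lp (fun a : (Σ k, S k) => L2 (a.1 : ℕ) (N a.1 a.2)) 2) :
    (∀ g, inner ℂ (concreteIncl hq0 N b g) x = 0) ↔
      ∀ᵐ t ∂(mu b.1.1 (N b.1.1 b.1.2)), t ∈ cellSet q b.2 → x b.1 t = 0 := by
  rw [← forall_inner_cellMap_eq_zero hq0]
  exact forall_congr' fun g => by rw [inner_concreteIncl]

theorem isHilbertSum_stdIncl [∀ k, CompleteSpace (K k)]
    (horth : ∀ k, OrthogonalFamily ℂ (fun v => CellL2 (N k v)) (Φ k))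
    (htop : ∀ k, (⨆ v, LinearMap.range (Φ k v).toLinearMap).topologicalClosure = ⊤) :
    IsHilbertSum ℂ (fun b : Σ a : (Σ k, S k), Idx (a.1 : ℕ) => CellL2 (N b.1.1 b.1.2))
      (stdIncl Φ) :=
  isHilbertSum_of_forall_inner (orthogonalFamily_stdIncl horth) fun x hx =>
    lp.ext (funext fun k => lp.ext (funext fun i =>
      (apply_eq_zero_iff htop x k i).mpr fun v g => hx ⟨⟨k, v⟩, i⟩ g))

theorem isHilbertSum_concreteIncl (hq0 : 0 < q) (hq1 : q < 1) :
    IsHilbertSum ℂ (fun b : Σ a : (Σ k, S k), Idx (a.1 : ℕ) => CellL2 (N b.1.1 b.1.2))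
      (concreteIncl hq0 N) :=
  isHilbertSum_of_forall_inner (orthogonalFamily_concreteIncl hq0 hq1) fun x hx =>
    lp.ext (funext fun a => eq_zero_of_vanishes_on_cells hq0 hq1 fun i =>
      (vanishes_iff hq0 ⟨a, i⟩ x).mp fun g => hx ⟨a, i⟩ g)

variable {U : lp (fun k : Fin n => StdSpace (k : ℕ) (K k)) 2 ≃ₗᵢ[ℂ]
    lp (fun a : (Σ k, S k) => L2 (a.1 : ℕ) (N a.1 a.2)) 2}

/-- Both graphs are closed spans of elementary pairs, given by a summand, an index and a function in
`L²((q, 1], ν)`. The map `U × U` takes one set of pairs onto the other, and being a homeomorphism it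
respects closed spans. -/
theorem intertwines_of_incl [∀ k, CompleteSpace (K k)] (hq0 : 0 < q) (hq1 : q < 1)
    {A : ∀ k, K k →L[ℂ] K k} (hA : ∀ k, IsSelfAdjoint (A k))
    (htop : ∀ k, (⨆ v, LinearMap.range (Φ k v).toLinearMap).topologicalClosure = ⊤)
    (hmul : ∀ k v g, A k (Φ k v g) = Φ k v (mulOp _ g))
    (hU : ∀ b g, U (stdIncl Φ b g) = concreteIncl hq0 N b g) :
    Intertwines U
      (fun j : Fin n => hilbertSum fun k : Fin n => (stdOp (q : ℝ) (k : ℕ) (A k) j).closure)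
      (fun j : Fin n =>
        hilbertSum fun a : (Σ k, S k) => (concreteOp (a.1 : ℕ) (N a.1 a.2) j).closure) := by
  classical
  intro j x y
  rw [graph_hilbertSum (fun k => graph_closure_stdOp hq0 hq1 (hA k) (htop k) (hmul k) k.2 j),
    graph_hilbertSum (fun a : (Σ k, S k) =>
      graph_closure_concreteOp hq0 hq1 a.1.2 (N a.1 a.2) j)]
  let W := U.toContinuousLinearEquiv.prodCongr U.toContinuousLinearEquiv
  have hW : ∀ (a : Σ k, S k) (i : Idx (a.1 : ℕ)) (g : CellL2 (N a.1 a.2)),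
      W (stdIncl Φ ⟨a, i⟩ g, stdIncl Φ ⟨a, raiseIdx a.1 j i⟩
          ((stdCoef (q : ℝ) a.1 j i : ℂ) • mulOp _ g)) =
        (concreteIncl hq0 N ⟨a, i⟩ g, concreteIncl hq0 N ⟨a, raiseIdx a.1 j i⟩
          ((stdCoef (q : ℝ) a.1 j i : ℂ) • mulOp _ g)) := fun a i g =>
    Prod.ext (hU ⟨a, i⟩ _) (hU ⟨a, raiseIdx a.1 j i⟩ _)
  refine (mem_closure_span_image_iff W _ (x, y)).symm.trans (iff_of_eq ?_)
  congr 3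
  ext p
  simp only [Set.mem_image, Set.mem_iUnion]
  constructor
  · rintro ⟨_, ⟨k, _, ⟨v, i, g, rfl⟩, rfl⟩, rfl⟩
    exact ⟨⟨k, v⟩, _, ⟨i, g, rfl⟩, (hW ⟨k, v⟩ i g).symm⟩
  · rintro ⟨⟨k, v⟩, _, ⟨i, g, rfl⟩, rfl⟩
    exact ⟨_, ⟨k, _, ⟨v, i, g, rfl⟩, rfl⟩, hW ⟨k, v⟩ i g⟩

theorem mem_stdDomain_iff_of_incl [∀ k, CompleteSpace (K k)] (hq0 : 0 < q) (hq1 : q < 1)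
    (htop : ∀ k, (⨆ v, LinearMap.range (Φ k v).toLinearMap).topologicalClosure = ⊤)
    (hU : ∀ b g, U (stdIncl Φ b g) = concreteIncl hq0 N b g)
    (x : lp (fun k : Fin n => StdSpace (k : ℕ) (K k)) 2) :
    (∀ k : Fin n, x k ∈ stdDomain (k : ℕ) (K k)) ↔
      ∃ C : ∀ k : Fin n, Set (X q (k : ℕ)), (∀ k, IsCompactPos (C k)) ∧
        ∀ a : (Σ k, S k), VanishesOff (U x a) (C a.1) := by
  -- The component of `x` at `i` vanishes iff all summands with the same `k` vanish on the cell `i`.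
  -- The quantifier over `v` is what makes one compact set `C k` serve all summands at once.
  have hzero : ∀ (k : Fin n) (i : Idx k), x k i = 0 ↔
      ∀ v : S k, ∀ᵐ t ∂(mu k (N k v)), t ∈ cellSet q i → U x ⟨k, v⟩ t = 0 := by
    intro k i
    rw [apply_eq_zero_iff htop]
    refine forall_congr' fun v => ?_
    rw [← vanishes_iff hq0 ⟨⟨k, v⟩, i⟩ (U x)]
    refine forall_congr' fun g => ?_
    rw [← hU, LinearIsometryEquiv.inner_map_map]
  constructor
  · intro h
    have hfin : ∀ k : Fin n, {i : Idx k | x k i ≠ 0}.Finite := h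
    choose C hC hFC using fun k : Fin n => isCompactPos_iUnion_cells hq0 (hfin k).toFinset
    refine ⟨C, hC, fun a => ?_⟩
    refine vanishesOff_of_cells hq0 hq1 (F := {i : Idx a.1 | x a.1 i ≠ 0})
      (fun i hi => hFC a.1 i (by simpa using hi)) fun i hi => ?_
    exact (hzero a.1 i).mp (by simpa using hi) a.2
  · rintro ⟨C, hC, hv⟩ k
    refine (finite_cells_of_isCompactPos hq0 hq1 (hC k)).subset fun i hi => ?_
    by_contra hc
    exact hi ((hzero k i).mpr fun v => (hv ⟨k, v⟩).ae_cell hc)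

end Unitary

end QPlane

end

open QPlane in
theorem theorem2 (q : ℝ≥0) (hq0 : 0 < q) (hq1 : q < 1) (n : ℕ) :
    (∀ (k : Fin n) (N : QInvMeasure q),
      (∀ j : Fin n, (concreteOp (k : ℕ) N j).domain = compDomain (k : ℕ) N) ∧
      IsStarRep (q : ℝ) (compDomain (k : ℕ) N)
        (fun j : Fin n => (concreteOp (k : ℕ) N j).closure)) ∧
    (∀ (H₀ : Type u) [NormedAddCommGroup H₀] [InnerProductSpace ℂ H₀] [CompleteSpace H₀]
      (K : Fin n → Type u) [∀ k, NormedAddCommGroup (K k)] [∀ k, InnerProductSpace ℂ (K k)]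
      [∀ k, CompleteSpace (K k)] (A : ∀ k, K k →L[ℂ] K k),
      (∀ k, IsSelfAdjoint (A k)) →
      (∀ k, spectrum ℂ (A k) ⊆ Complex.ofReal '' Set.Icc (q : ℝ) 1) →
      (∀ k, ¬ Module.End.HasEigenvalue (A k : K k →ₗ[ℂ] K k) ((q : ℝ) : ℂ)) →
      ∃ (ι : Type u) (κ : ι → Fin n) (N : ι → QInvMeasure q)
        (U : WithLp 2 (H₀ × lp (fun k : Fin n => StdSpace (k : ℕ) (K k)) 2) ≃ₗᵢ[ℂ]
          WithLp 2 (H₀ × lp (fun a : ι => L2 (κ a : ℕ) (N a)) 2)),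
        Intertwines U
          (fun j : Fin n => zeroSum H₀
            (hilbertSum fun k : Fin n => (stdOp (q : ℝ) (k : ℕ) (A k) j).closure))
          (fun j : Fin n => zeroSum H₀
            (hilbertSum fun a : ι => (concreteOp (κ a : ℕ) (N a) j).closure)) ∧
        ∀ x, (∀ k : Fin n, x.snd k ∈ stdDomain (k : ℕ) (K k)) ↔
          ∃ C : ∀ k : Fin n, Set (X q (k : ℕ)),
            (∀ k, IsCompactPos (C k)) ∧
            ∀ a : ι, VanishesOff ((U x).snd a) (C (κ a))) := by
  refine ⟨fun k N => ⟨fun j => concreteOp_domain hq0 hq1 k N j,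
    (isStarRep_concreteOp hq0 hq1 k.2 N).2⟩, ?_⟩
  intro H₀ _ _ _ K _ _ _ A hA hs hev
  choose S N Φ horth htop hmul using
    fun k => exists_cell_decomposition hq0 hq1 (hA k) (hs k) (hev k)
  have hE := isHilbertSum_stdIncl horth htop
  have hF := isHilbertSum_concreteIncl (S := fun k => S k) (N := N) hq0 hq1
  -- Both spaces are Hilbert sums of the same family of spaces with the same index set, so `U`
  -- passes through their common external sum.
  let U := hE.linearIsometryEquiv.trans hF.linearIsometryEquiv.symm
  have hU : ∀ b g, U (stdIncl Φ b g) = concreteIncl hq0 N b g := by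
    classical
    intro b g
    change hF.linearIsometryEquiv.symm (hE.linearIsometryEquiv (stdIncl Φ b g)) = _
    rw [← hE.linearIsometryEquiv_symm_apply_single, LinearIsometryEquiv.apply_symm_apply,
      hF.linearIsometryEquiv_symm_apply_single]
  refine ⟨Σ k, S k, fun a => a.1, fun a => N a.1 a.2,
    LinearIsometryEquiv.withLpProdCongr 2 (LinearIsometryEquiv.refl ℂ H₀) U, ?_, ?_⟩
  · intro j x y
    rw [mem_graph_zeroSum, mem_graph_zeroSum]
    exact and_congr_right fun _ =>
      intertwines_of_incl hq0 hq1 hA htop hmul hU j x.snd y.snd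
  · exact fun x => mem_stdDomain_iff_of_incl hq0 hq1 htop hU x.snd
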